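/- Let $k$ be a field of characteristic $0$ and let $B=\bigoplus_{d\ge 0}B_d$ be a commutative graded $k$-algebra that is generated as a $k$-algebra by $B_1$, with $\dim_k B_1<\infty$. For $d\ge 0$ and $m\ge 0$ let $\mathcal I_B(1)_{d,m}$ be the kernel of the multiplication map $\mathrm{Sym}^m(B_d)\to B_{dm}$, and for $r\ge 2$ let $\mathcal I_B(r)_{d,m}$ be the kernel of the map $$\mathrm{Sym}^m(B_d)\to\bigoplus_{i=0}^m \mathrm{Sym}^i(B_d)/\mathcal I_B(1)_{d,i}\otimes_k \mathrm{Sym}^{m-i}(B_d)/\mathcal I_B(r-1)_{d,m-i}$$ induced by the comultiplication of $\mathrm{Sym}(B_d)$ (the algebra map with $v\mapsto v\otimes 1+1\otimes v$ for $v\in B_d$). For fixed $d$ and $r$, $\bigoplus_m\mathcal I_B(r)_{d,m}$ is a homogeneous ideal of $\mathrm{Sym}(B_d)$; put $\mathrm{Sec}_{d,r}(B)=\bigoplus_{m\ge 0}\mathrm{Sym}^m(B_d)/\mathcal I_B(r)_{d,m}$, a graded quotient algebra of $\mathrm{Sym}(B_d)$, where $\mathrm{Sym}^m(B_d)$ has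 degree $m$. Theorem. There is a function $C_B\colon \mathbf Z_{\ge 0}\times\mathbf Z_{\ge 1}\to\mathbf Z_{\ge 0}$, depending only on $B$, such that for all $i\ge 0$, $r\ge 1$ and $d\ge 0$ the graded vector space $\mathrm{Tor}_i^{\mathrm{Sym}(B_d)}(\mathrm{Sec}_{d,r}(B),k)$ is concentrated in degrees $\le C_B(i,r)$, where $k=\mathrm{Sym}(B_d)/\mathrm{Sym}(B_d)_+$ is placed in degree $0$. The bound $C_B(i,r)$ does not depend on $d$. -/

import Mathlib

open scoped TensorProduct

universe u v w w'

/-! ## Graded modules, graded free resolutions and graded Tor -/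

section GradedTor

variable {k : Type u} [Field k] {S : Type w} [CommRing S] [Algebra k S]

/-- `ℳ` makes the `S`-module `M` into an `ℕ`-graded module over the graded `k`-algebra
`S = ⨁ 𝒜 a`: one has `𝒜 a • ℳ b ⊆ ℳ (a + b)` and `M = ⨁ ℳ b`. -/
structure IsGradedModule (𝒜 : ℕ → Submodule k S) {M : Type w'} [AddCommGroup M] [Module S M]
    [Module k M] (ℳ : ℕ → Submodule k M) : Prop where
  smul_mem : ∀ a b : ℕ, ∀ s ∈ 𝒜 a, ∀ x ∈ ℳ b, s • x ∈ ℳ (a + b)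
  isInternal : DirectSum.IsInternal ℳ

/-- The degree `j` part of the graded free `S`-module with basis `G`, where the basis vector `g`
has degree `deg g`; that is, the degree `j` part of `⨁ g, S(-deg g)`. -/
noncomputable def freeDegree (𝒜 : ℕ → Submodule k S) {G : Type w'} (deg : G → ℕ) (j : ℕ) :
    Submodule k (G →₀ S) :=
  Submodule.span k {f | ∃ g a, a + deg g = j ∧ ∃ s ∈ 𝒜 a, f = Finsupp.single g s}

/-- A graded free resolution `⋯ → F 1 → F 0 → M → 0` of the graded module `M`: `F n` is the graded
free module with homogeneous basis `gen n`, and the maps preserve degrees and are exact. -/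
structure GradedFreeResolution (𝒜 : ℕ → Submodule k S) {M : Type w} [AddCommGroup M] [Module S M]
    [Module k M] (ℳ : ℕ → Submodule k M) where
  /-- the basis of the `n`-th free module -/
  gen : ℕ → Type w
  /-- the degrees of the basis vectors -/
  deg : ∀ n, gen n → ℕ
  /-- the differential -/
  d : ∀ n, (gen (n + 1) →₀ S) →ₗ[S] (gen n →₀ S)
  /-- the augmentation -/
  aug : (gen 0 →₀ S) →ₗ[S] M
  d_degree : ∀ n g, d n (Finsupp.single g 1) ∈ freeDegree 𝒜 (deg n) (deg (n + 1) g)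
  aug_degree : ∀ g, aug (Finsupp.single g 1) ∈ ℳ (deg 0 g)
  aug_surjective : Function.Surjective aug
  exact_zero : Function.Exact (d 0) aug
  exact_succ : ∀ n, Function.Exact (d (n + 1)) (d n)

namespace GradedFreeResolution

variable {𝒜 : ℕ → Submodule k S} {M : Type w} [AddCommGroup M] [Module S M] [Module k M]
  {ℳ : ℕ → Submodule k M} (F : GradedFreeResolution 𝒜 ℳ)
  (N : Type w') [AddCommGroup N] [Module S N]

/-- The `n`-th free module `F n`. -/
def obj (n : ℕ) : Type w := F.gen n →₀ S

noncomputable instance (n : ℕ) : AddCommGroup (F.obj n) :=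
  inferInstanceAs (AddCommGroup (F.gen n →₀ S))

noncomputable instance (n : ℕ) : Module S (F.obj n) := inferInstanceAs (Module S (F.gen n →₀ S))

noncomputable instance (n : ℕ) : Module k (F.obj n) := inferInstanceAs (Module k (F.gen n →₀ S))

instance (n : ℕ) : IsScalarTower k S (F.obj n) :=
  inferInstanceAs (IsScalarTower k S (F.gen n →₀ S))

/-- The differential `F (n + 1) → F n`. -/
def dObj (n : ℕ) : F.obj (n + 1) →ₗ[S] F.obj n := F.d n

/-- The degree `j` part of `F n`. -/
noncomputable def objDegree (n j : ℕ) : Submodule k (F.obj n) := freeDegree 𝒜 (F.deg n) j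

/-- The `n`-th term `F n ⊗ N` of the complex computing Tor. -/
abbrev term (n : ℕ) : Type (max w w') := F.obj n ⊗[S] N

/-- The differential `F (n + 1) ⊗ N → F n ⊗ N`. -/
noncomputable def diff (n : ℕ) : F.term N (n + 1) →ₗ[S] F.term N n := (F.dObj n).rTensor N

/-- The cycles of the complex `F ⊗ N`. -/
noncomputable def cycles : ∀ n, Submodule S (F.term N n)
  | 0 => ⊤
  | n + 1 => LinearMap.ker (F.diff N n)

/-- The boundaries of the complex `F ⊗ N`. -/
noncomputable def boundaries (n : ℕ) : Submodule S (F.term N n) := LinearMap.range (F.diff N n)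

/-- The `n`-th homology of `F ⊗ N`. -/
abbrev homology (n : ℕ) : Type (max w w') :=
  F.cycles N n ⧸ (F.boundaries N n).submoduleOf (F.cycles N n)

variable {N} [Module k N] (𝒩 : ℕ → Submodule k N)

/-- The degree `j` part of `F n ⊗ N`, for the total grading. -/
noncomputable def termDegree (n j : ℕ) : Submodule k (F.term N n) :=
  Submodule.span k {t | ∃ a b, a + b = j ∧
    ∃ f ∈ F.objDegree n a, ∃ y ∈ 𝒩 b, t = f ⊗ₜ[S] y}

/-- The degree `j` part of the `n`-th homology of `F ⊗ N`: the classes of the cycles of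
degree `j`. -/
noncomputable def homologyDegree (n j : ℕ) : Submodule k (F.homology N n) :=
  ((F.termDegree 𝒩 n j).comap ((F.cycles N n).subtype.restrictScalars k)).map
    (((F.boundaries N n).submoduleOf (F.cycles N n)).mkQ.restrictScalars k)

end GradedFreeResolution

section Standard

variable {𝒜 : ℕ → Submodule k S}

lemma single_mem_freeDegree {G : Type w'} (deg : G → ℕ) (g : G) {a j : ℕ} (h : a + deg g = j)
    {s : S} (hs : s ∈ 𝒜 a) : Finsupp.single g s ∈ freeDegree 𝒜 deg j :=
  Submodule.subset_span ⟨g, a, h, s, hs, rfl⟩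

lemma iSup_freeDegree [GradedAlgebra 𝒜] {G : Type w'} (deg : G → ℕ) :
    ⨆ j, freeDegree 𝒜 deg j = ⊤ := by
  classical
  refine eq_top_iff.2 fun f _ => ?_
  induction f using Finsupp.induction_linear with
  | zero => exact zero_mem _
  | add x y hx hy => exact add_mem (hx trivial) (hy trivial)
  | single g s =>
    rw [← DirectSum.sum_support_decompose 𝒜 s, Finsupp.single_finsetSum]
    exact sum_mem fun a _ => Submodule.mem_iSup_of_mem (a + deg g)
      (single_mem_freeDegree deg g rfl (SetLike.coe_mem _))

lemma apply_of_mem_freeDegree {G : Type w'} (deg : G → ℕ) {j : ℕ} {f : G →₀ S}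
    (hf : f ∈ freeDegree 𝒜 deg j) (g : G) :
    (deg g ≤ j → f g ∈ 𝒜 (j - deg g)) ∧ (¬ deg g ≤ j → f g = 0) := by
  classical
  induction hf using Submodule.span_induction with
  | zero => simp
  | add x y _ _ hx hy =>
    exact ⟨fun h => by simpa using add_mem (hx.1 h) (hy.1 h),
      fun h => by simp [hx.2 h, hy.2 h]⟩
  | smul c x _ hx =>
    exact ⟨fun h => by simpa using Submodule.smul_mem _ c (hx.1 h), fun h => by simp [hx.2 h]⟩
  | mem x hx =>
    obtain ⟨g', a, h, s, hs, rfl⟩ := hx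
    rw [Finsupp.single_apply]
    split_ifs with hg
    · subst hg
      refine ⟨fun _ => ?_, fun h' => absurd (by omega) h'⟩
      have : j - deg g' = a := by omega
      rwa [this]
    · exact ⟨fun _ => zero_mem _, fun _ => rfl⟩

lemma iSupIndep_freeDegree [GradedAlgebra 𝒜] {G : Type w'} (deg : G → ℕ) :
    iSupIndep (freeDegree 𝒜 deg) := by
  classical
  have hA := (DirectSum.Decomposition.isInternal 𝒜).submodule_iSupIndep
  rw [iSupIndep_iff_finsetSum_eq_zero_imp_eq_zero] at hA ⊢
  intro s v hv hsum j hj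
  ext g
  by_cases hjg : deg g ≤ j
  swap
  · exact (apply_of_mem_freeDegree deg (hv j hj) g).2 hjg
  have h1 := hA ((s.filter (deg g ≤ ·)).image (· - deg g)) (fun a => v (a + deg g) g) (by
    intro a ha
    simp only [Finset.mem_image, Finset.mem_filter] at ha
    obtain ⟨i, ⟨hi, hle⟩, rfl⟩ := ha
    have := (apply_of_mem_freeDegree deg (hv i hi) g).1 hle
    simpa [Nat.sub_add_cancel hle] using this) (by
    rw [Finset.sum_image]
    · have h2 : ∑ i ∈ s, v i g = 0 := by
        have := DFunLike.congr_fun hsum g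
        simpa [Finsupp.finsetSum_apply] using this
      rw [← h2, Finset.sum_filter]
      refine Finset.sum_congr rfl fun i hi => ?_
      split_ifs with hle
      · simp [Nat.sub_add_cancel hle]
      · exact ((apply_of_mem_freeDegree deg (hv i hi) g).2 hle).symm
    · intro a ha b hb hab
      simp only [Finset.coe_filter, Set.mem_ofPred_eq] at ha hb
      have := ha.2; have := hb.2
      simp only at hab
      omega) (j - deg g) (Finset.mem_image.2 ⟨j, Finset.mem_filter.2 ⟨hj, hjg⟩, rfl⟩)
  simpa [Nat.sub_add_cancel hjg] using h1

/-- The kernel of a degree-preserving map out of a graded free module is generated by its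
homogeneous elements. -/
lemma ker_le_span_homogeneous [GradedAlgebra 𝒜] {G : Type w} (deg : G → ℕ)
    {T : Type w} [AddCommGroup T] [Module S T] [Module k T]
    (𝒯 : ℕ → Submodule k T) (h𝒯 : iSupIndep 𝒯) (φ : (G →₀ S) →ₗ[S] T)
    (hφ : ∀ j, ∀ f ∈ freeDegree 𝒜 deg j, φ f ∈ 𝒯 j) :
    LinearMap.ker φ ≤
      Submodule.span S {f | f ∈ LinearMap.ker φ ∧ ∃ j, f ∈ freeDegree 𝒜 deg j} := by
  intro f hf
  have hft : f ∈ ⨆ j, freeDegree 𝒜 deg j := by rw [iSup_freeDegree]; trivial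
  obtain ⟨c, hc, rfl⟩ := (Submodule.mem_iSup_iff_exists_finsupp _ _).1 hft
  rw [iSupIndep_iff_finsetSum_eq_zero_imp_eq_zero] at h𝒯
  have h0 := h𝒯 c.support (fun j => φ (c j)) (fun j _ => hφ j _ (hc j)) (by
    rw [← map_sum]; exact hf)
  exact sum_mem fun j hj => Submodule.subset_span ⟨h0 j hj, j, hc j⟩

variable (𝒜)

/-- A graded free module together with a submodule (the relations to be resolved next). -/
structure StandardStage (S : Type w) [CommRing S] where
  /-- the basis -/
  gen : Type w
  /-- the degrees of the basis vectors -/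
  deg : gen → ℕ
  /-- the submodule of relations -/
  rel : Submodule S (gen →₀ S)

/-- The free module on the homogeneous elements of the relations in the preceding stage. -/
noncomputable def StandardStage.next (c : StandardStage S) : StandardStage S where
  gen := Σ j : ℕ, {f : c.gen →₀ S // f ∈ c.rel ∧ f ∈ freeDegree 𝒜 c.deg j}
  deg := Sigma.fst
  rel := LinearMap.ker (Finsupp.linearCombination S fun g => (g.2.1 : c.gen →₀ S))

variable {M : Type w} [AddCommGroup M] [Module S M] [Module k M] (ℳ : ℕ → Submodule k M)

/-- The free module on the homogeneous elements of `M`, with the relations between them. -/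
noncomputable def StandardStage.first : StandardStage S where
  gen := Σ j : ℕ, ℳ j
  deg := Sigma.fst
  rel := LinearMap.ker (Finsupp.linearCombination S fun g : (Σ j : ℕ, ℳ j) => (g.2.1 : M))

/-- The map from the next free module to the given one. -/
noncomputable def StandardStage.nextMap (c : StandardStage S) :
    ((c.next 𝒜).gen →₀ S) →ₗ[S] (c.gen →₀ S) :=
  Finsupp.linearCombination S
    fun g : (Σ j : ℕ, {f : c.gen →₀ S // f ∈ c.rel ∧ f ∈ freeDegree 𝒜 c.deg j}) => g.2.1

/-- The map from the free module on the homogeneous elements of `M` to `M`. -/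
noncomputable def StandardStage.firstMap :
    ((StandardStage.first (S := S) ℳ).gen →₀ S) →ₗ[S] M :=
  Finsupp.linearCombination S fun g : (Σ j : ℕ, ℳ j) => (g.2.1 : M)

/-- The stages of the standard graded free resolution of `M`. -/
noncomputable def standardStage : ℕ → StandardStage S
  | 0 => StandardStage.first ℳ
  | n + 1 => StandardStage.next 𝒜 (standardStage n)

variable {𝒜 ℳ}

lemma linearCombination_mem_degree {G : Type w} (deg : G → ℕ)
    {T : Type w} [AddCommGroup T] [Module S T] [Module k T] [IsScalarTower k S T]
    {𝒯 : ℕ → Submodule k T} (h𝒯 : ∀ a b : ℕ, ∀ s ∈ 𝒜 a, ∀ x ∈ 𝒯 b, s • x ∈ 𝒯 (a + b))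
    (v : G → T) (hv : ∀ g, v g ∈ 𝒯 (deg g)) (j : ℕ) (f : G →₀ S)
    (hf : f ∈ freeDegree 𝒜 deg j) : Finsupp.linearCombination S v f ∈ 𝒯 j := by
  induction hf using Submodule.span_induction with
  | zero => simp
  | add x y _ _ hx hy => rw [map_add]; exact add_mem hx hy
  | smul c x _ hx =>
    rw [LinearMap.map_smul_of_tower]; exact Submodule.smul_mem _ _ hx
  | mem x hx =>
    obtain ⟨g, a, rfl, s, hs, rfl⟩ := hx
    rw [Finsupp.linearCombination_single]
    exact h𝒯 _ _ _ hs _ (hv g)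

lemma freeDegree_smul_mem [GradedAlgebra 𝒜] {G : Type w} (deg : G → ℕ) (a b : ℕ) (s : S)
    (hs : s ∈ 𝒜 a) (x : G →₀ S) (hx : x ∈ freeDegree 𝒜 deg b) :
    s • x ∈ freeDegree 𝒜 deg (a + b) := by
  induction hx using Submodule.span_induction with
  | zero => simp
  | add x y _ _ hx hy => rw [smul_add]; exact add_mem hx hy
  | smul c x _ hx => rw [smul_comm]; exact Submodule.smul_mem _ _ hx
  | mem x hx =>
    obtain ⟨g, b', rfl, t, ht, rfl⟩ := hx
    rw [Finsupp.smul_single, smul_eq_mul]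
    exact single_mem_freeDegree deg g (by omega) (SetLike.GradedMul.mul_mem hs ht)

lemma standardStage_rel [GradedAlgebra 𝒜] [IsScalarTower k S M] (hℳ : IsGradedModule 𝒜 ℳ)
    (n : ℕ) : (standardStage 𝒜 ℳ n).rel ≤ Submodule.span S {f | f ∈ (standardStage 𝒜 ℳ n).rel ∧
      ∃ j, f ∈ freeDegree 𝒜 (standardStage 𝒜 ℳ n).deg j} := by
  cases n with
  | zero =>
    exact ker_le_span_homogeneous (G := Σ j : ℕ, ℳ j) Sigma.fst ℳ
      hℳ.isInternal.submodule_iSupIndep _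
      (linearCombination_mem_degree _ hℳ.smul_mem _ fun g => g.2.2)
  | succ n =>
    exact ker_le_span_homogeneous (G := (StandardStage.next 𝒜 (standardStage 𝒜 ℳ n)).gen)
      Sigma.fst _ (iSupIndep_freeDegree _) _
      (linearCombination_mem_degree _ (freeDegree_smul_mem _) _ fun g => g.2.2.2)

lemma StandardStage.nextMap_single (c : StandardStage S) (g : (c.next 𝒜).gen) :
    c.nextMap 𝒜 (Finsupp.single g 1) = g.2.1 :=
  (Finsupp.linearCombination_single S (1 : S) g).trans (one_smul S _)

lemma StandardStage.firstMap_single (g : (StandardStage.first (S := S) ℳ).gen) :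
    StandardStage.firstMap (S := S) ℳ (Finsupp.single g 1) = g.2.1 :=
  (Finsupp.linearCombination_single S (1 : S) g).trans (one_smul S _)

lemma StandardStage.firstMap_surjective (hℳ : IsGradedModule 𝒜 ℳ) :
    Function.Surjective (StandardStage.firstMap (S := S) ℳ) := by
  intro x
  have hx : x ∈ ⨆ j, ℳ j := by rw [hℳ.isInternal.submodule_iSup_eq_top]; trivial
  obtain ⟨c, hc, rfl⟩ := (Submodule.mem_iSup_iff_exists_finsupp _ _).1 hx
  refine LinearMap.mem_range.1 (sum_mem fun j _ => ?_)
  exact ⟨_, StandardStage.firstMap_single (ℳ := ℳ) ⟨j, c j, hc j⟩⟩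

lemma standardStage_exact [GradedAlgebra 𝒜] [IsScalarTower k S M] (hℳ : IsGradedModule 𝒜 ℳ)
    (n : ℕ) : LinearMap.range ((standardStage 𝒜 ℳ n).nextMap 𝒜) = (standardStage 𝒜 ℳ n).rel := by
  refine le_antisymm ?_ ?_
  · refine (Finsupp.range_linearCombination S).trans_le (Submodule.span_le.2 ?_)
    rintro _ ⟨g, rfl⟩
    exact g.2.2.1
  · refine (standardStage_rel hℳ n).trans (Submodule.span_le.2 ?_)
    rintro f ⟨hf, j, hj⟩
    exact ⟨_, StandardStage.nextMap_single (standardStage 𝒜 ℳ n) ⟨j, f, hf, hj⟩⟩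

variable (𝒜 ℳ)

/-- The standard graded free resolution of a graded module `M`: the free module on the homogeneous
elements of `M`, then the free module on the homogeneous relations, and so on. -/
noncomputable def standardResolution [GradedAlgebra 𝒜] [IsScalarTower k S M]
    (hℳ : IsGradedModule 𝒜 ℳ) : GradedFreeResolution 𝒜 ℳ where
  gen n := (standardStage 𝒜 ℳ n).gen
  deg n := (standardStage 𝒜 ℳ n).deg
  d n := (standardStage 𝒜 ℳ n).nextMap 𝒜
  aug := StandardStage.firstMap ℳ
  d_degree n g := by
    have h := StandardStage.nextMap_single (standardStage 𝒜 ℳ n) g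
    exact h.symm ▸ g.2.2.2
  aug_degree g := by
    have h := StandardStage.firstMap_single (S := S) (ℳ := ℳ) g
    exact h.symm ▸ g.2.2
  aug_surjective := StandardStage.firstMap_surjective hℳ
  exact_zero f := (SetLike.ext_iff.1 (standardStage_exact hℳ 0) f).symm
  exact_succ n f := (SetLike.ext_iff.1 (standardStage_exact hℳ (n + 1)) f).symm

end Standard

/-- The module `Tor_i^S(M, N)` of a graded module `M` and a module `N`, as the homology of
`F ⊗ N` for the standard graded free resolution `F` of `M`. -/
abbrev GradedTor (𝒜 : ℕ → Submodule k S) [GradedAlgebra 𝒜]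
    {M : Type w} [AddCommGroup M] [Module S M] [Module k M] [IsScalarTower k S M]
    {ℳ : ℕ → Submodule k M} (hℳ : IsGradedModule 𝒜 ℳ)
    (N : Type w') [AddCommGroup N] [Module S N] (i : ℕ) : Type (max w w') :=
  (standardResolution 𝒜 ℳ hℳ).homology N i

/-- The degree `j` part of `Tor_i^S(M, N)`, for graded modules `M` and `N`. -/
noncomputable def gradedTorDegree (𝒜 : ℕ → Submodule k S) [GradedAlgebra 𝒜]
    {M : Type w} [AddCommGroup M] [Module S M] [Module k M] [IsScalarTower k S M]
    {ℳ : ℕ → Submodule k M} (hℳ : IsGradedModule 𝒜 ℳ)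
    {N : Type w'} [AddCommGroup N] [Module S N] [Module k N] (𝒩 : ℕ → Submodule k N)
    (i j : ℕ) : Submodule k (GradedTor 𝒜 hℳ N i) :=
  (standardResolution 𝒜 ℳ hℳ).homologyDegree 𝒩 i j

end GradedTor

/-! ## The graded symmetric algebra -/

section Sym

variable (k : Type u) [Field k] (V : Type v) [AddCommGroup V] [Module k V]

/-- The `m`-th symmetric power of `V`, as a subspace of the symmetric algebra. -/
def symPow (m : ℕ) : Submodule k (SymmetricAlgebra k V) :=
  LinearMap.range (SymmetricAlgebra.ι k V) ^ m

instance symPow.gradedMonoid : SetLike.GradedMonoid (symPow k V) :=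
  inferInstanceAs (SetLike.GradedMonoid fun m : ℕ => LinearMap.range (SymmetricAlgebra.ι k V) ^ m)

lemma ι_mem_symPow (x : V) : SymmetricAlgebra.ι k V x ∈ symPow k V 1 := by
  simp [symPow]

/-- The inclusion of `V` into the external direct sum of its symmetric powers. -/
noncomputable def symPow.ι : V →ₗ[k] DirectSum ℕ fun m => symPow k V m :=
  DirectSum.lof k ℕ (fun m => symPow k V m) 1 ∘ₗ
    (SymmetricAlgebra.ι k V).codRestrict _ (ι_mem_symPow k V)

/-- `Sym(V) = ⨁ Sym^m(V)` as a graded algebra. -/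
noncomputable instance symPow.gradedAlgebra : GradedAlgebra (symPow k V) :=
  GradedAlgebra.ofAlgHom _ (SymmetricAlgebra.lift (symPow.ι k V))
    (by
      ext x
      simp [symPow.ι, DirectSum.lof_eq_of, DirectSum.coeAlgHom_of])
    fun i x => by
      obtain ⟨x, hx⟩ := x
      dsimp only
      unfold symPow at hx
      induction hx using Submodule.pow_induction_on_left' with
      | algebraMap r =>
        rw [AlgHom.commutes, DirectSum.algebraMap_apply]; rfl
      | add x y i hx hy ihx ihy =>
        rw [map_add, ihx, ihy, ← map_add]
        rfl
      | mem_mul m hm i x hx ih =>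
        obtain ⟨y, rfl⟩ := hm
        rw [map_mul, ih, SymmetricAlgebra.lift_ι_apply]
        simp only [symPow.ι, LinearMap.comp_apply, DirectSum.lof_eq_of]
        rw [DirectSum.of_mul_of]
        exact DirectSum.of_eq_of_gradedMonoid_eq (Sigma.subtype_ext (add_comm _ _) rfl)

/-- The field `k` viewed as the graded `Sym(V)`-module `Sym(V) / Sym(V)₊`. -/
def ResidueModule (_V : Type v) : Type u := k

noncomputable instance : AddCommGroup (ResidueModule k V) := inferInstanceAs (AddCommGroup k)

noncomputable instance : Module k (ResidueModule k V) := inferInstanceAs (Module k k)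

noncomputable instance : Module (SymmetricAlgebra k V) (ResidueModule k V) :=
  Module.compHom k (SymmetricAlgebra.algebraMapInv : SymmetricAlgebra k V →ₐ[k] k).toRingHom

/-- The grading of `k`, concentrated in degree `0`. -/
noncomputable def residueDegree (j : ℕ) : Submodule k (ResidueModule k V) := if j = 0 then ⊤ else ⊥

end Sym

/-! ## Homogeneous quotients -/

section Quotient

variable {k : Type u} [Field k] {S : Type w} [CommRing S] [Algebra k S]
  (𝒜 : ℕ → Submodule k S) [GradedAlgebra 𝒜] (I : HomogeneousIdeal 𝒜)

/-- The degree `m` part of `S / I`, namely the image of `𝒜 m`. -/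
noncomputable def quotientDegree (m : ℕ) : Submodule k (S ⧸ I.toIdeal) :=
  (𝒜 m).map (Ideal.Quotient.mkₐ k I.toIdeal).toLinearMap

lemma quotientDegree_isGradedModule : IsGradedModule 𝒜 (quotientDegree 𝒜 I) where
  smul_mem := by
    rintro a b s hs _ ⟨x, hx, rfl⟩
    exact ⟨s * x, SetLike.GradedMul.mul_mem hs hx, by simp [Algebra.smul_def]⟩
  isInternal := by
    classical
    refine DirectSum.isInternal_submodule_of_iSupIndep_of_iSup_eq_top ?_ ?_
    · rw [iSupIndep_iff_finsetSum_eq_zero_imp_eq_zero]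
      intro s v hv hsum j hj
      choose! x hx hxv using hv
      have hI : ∑ i ∈ s, x i ∈ I.toIdeal := by
        rw [← Ideal.Quotient.eq_zero_iff_mem, map_sum, ← hsum]
        exact Finset.sum_congr rfl fun i hi => hxv i hi
      have hj' := I.isHomogeneous j hI
      have : (DirectSum.decompose 𝒜 (∑ i ∈ s, x i) j : S) = x j := by
        rw [DirectSum.decompose_sum, DFinsupp.finsetSum_apply, AddSubmonoidClass.coe_finsetSum,
          Finset.sum_eq_single j]
        · exact DirectSum.decompose_of_mem_same _ (hx j hj)
        · intro i hi hij
          exact DirectSum.decompose_of_mem_ne _ (hx i hi) hij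
        · exact fun h => absurd hj h
      rw [← hxv j hj]
      rw [this] at hj'
      exact Ideal.Quotient.eq_zero_iff_mem.2 hj'
    · unfold quotientDegree
      rw [← Submodule.map_iSup, (DirectSum.Decomposition.isInternal 𝒜).submodule_iSup_eq_top,
        Submodule.map_top, LinearMap.range_eq_top]
      exact Ideal.Quotient.mk_surjective

end Quotient

/-! ## Secant ideals -/

section Secant

variable {k : Type u} [Field k] {B : Type v} [CommRing B] [Algebra k B]
  (𝓑 : ℕ → Submodule k B) (d : ℕ)

/-- The multiplication map `Sym(B_d) → B`, which sends `Sym^m(B_d)` into `B_{dm}`. -/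
noncomputable def veroneseMul : SymmetricAlgebra k (𝓑 d) →ₐ[k] B :=
  SymmetricAlgebra.lift (𝓑 d).subtype

/-- The ideal `⨁ m, I_B(1)_{d,m}`, where `I_B(1)_{d,m}` is the kernel of the multiplication map
`Sym^m(B_d) → B_{dm}`. -/
noncomputable def veroneseIdeal : HomogeneousIdeal (symPow k (𝓑 d)) :=
  (RingHom.ker (veroneseMul 𝓑 d)).homogeneousCore (symPow k (𝓑 d))

/-- The comultiplication `Sym(V) → Sym(V) ⊗ Sym(V)`, `v ↦ v ⊗ 1 + 1 ⊗ v` for `v` in `V = B_d`,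
followed by the projection to `Sym(V) / I ⊗ Sym(V) / J`. For homogeneous `I` and `J` its
restriction to `Sym^m(V)` has values in the summand `⨁ i, (Sym^i(V) / I_i) ⊗ (Sym^(m-i)(V) / J_{m-i})`
of the target. -/
noncomputable def secantComul (I J : HomogeneousIdeal (symPow k (𝓑 d))) :
    SymmetricAlgebra k (𝓑 d) →ₐ[k]
      (SymmetricAlgebra k (𝓑 d) ⧸ I.toIdeal) ⊗[k] (SymmetricAlgebra k (𝓑 d) ⧸ J.toIdeal) :=
  (Algebra.TensorProduct.map (Ideal.Quotient.mkₐ k I.toIdeal)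
    (Ideal.Quotient.mkₐ k J.toIdeal)).comp (Bialgebra.comulAlgHom k _)

/-- The secant ideal `⨁ m, I_B(r)_{d,m}` of `Sym(B_d)`. Here `I_B(1)_{d,m}` is the kernel of
multiplication, and `I_B(r)_{d,m}` for `r ≥ 2` is the kernel of the comultiplication map
`Sym^m(B_d) → ⨁ i, Sym^i(B_d) / I_B(1)_{d,i} ⊗ Sym^(m-i)(B_d) / I_B(r-1)_{d,m-i}`.
The value at `r = 0` is a convention (the ideal of the origin). -/
noncomputable def secantIdeal : ℕ → HomogeneousIdeal (symPow k (𝓑 d))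
  | 0 => HomogeneousIdeal.irrelevant (symPow k (𝓑 d))
  | 1 => veroneseIdeal 𝓑 d
  | r + 2 => (RingHom.ker (secantComul 𝓑 d (veroneseIdeal 𝓑 d)
      (secantIdeal (r + 1)))).homogeneousCore (symPow k (𝓑 d))

lemma mem_homogeneousCore_iff {S : Type w} [CommRing S] [Algebra k S] (𝒜 : ℕ → Submodule k S)
    [GradedAlgebra 𝒜] (I : Ideal S) {m : ℕ} {x : S} (hx : x ∈ 𝒜 m) :
    x ∈ I.homogeneousCore 𝒜 ↔ x ∈ I :=
  ⟨fun h => Ideal.toIdeal_homogeneousCore_le 𝒜 I h,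
    fun h => Ideal.mem_homogeneousCore_of_homogeneous_of_mem ⟨m, hx⟩ h⟩

/-- The degree `m` part of the first secant ideal is the kernel of `Sym^m(B_d) → B_{dm}`. -/
lemma mem_secantIdeal_one {m : ℕ} {x : SymmetricAlgebra k (𝓑 d)} (hx : x ∈ symPow k (𝓑 d) m) :
    x ∈ secantIdeal 𝓑 d 1 ↔ veroneseMul 𝓑 d x = 0 :=
  mem_homogeneousCore_iff _ _ hx

/-- The degree `m` part of the higher secant ideals is the kernel of the comultiplication map. -/
lemma mem_secantIdeal_succ {r m : ℕ} {x : SymmetricAlgebra k (𝓑 d)}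
    (hx : x ∈ symPow k (𝓑 d) m) :
    x ∈ secantIdeal 𝓑 d (r + 2) ↔
      secantComul 𝓑 d (secantIdeal 𝓑 d 1) (secantIdeal 𝓑 d (r + 1)) x = 0 :=
  mem_homogeneousCore_iff _ _ hx

/-- The algebra `Sec_{d,r}(B) = ⨁ m, Sym^m(B_d) / I_B(r)_{d,m}`. -/
abbrev Sec (r : ℕ) : Type (max u v) := SymmetricAlgebra k (𝓑 d) ⧸ (secantIdeal 𝓑 d r).toIdeal

/-- `Sec_{d,r}(B)` is a graded `Sym(B_d)`-module, with `Sym^m(B_d) / I_B(r)_{d,m}` in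
degree `m`. -/
lemma Sec.isGradedModule (r : ℕ) :
    IsGradedModule (symPow k (𝓑 d)) (quotientDegree (symPow k (𝓑 d)) (secantIdeal 𝓑 d r)) :=
  quotientDegree_isGradedModule _ _

/-- The degree `j` part of `Tor_i^{Sym(B_d)}(Sec_{d,r}(B), k)`. -/
noncomputable def secantTorDegree (r i j : ℕ) :
    Submodule k (GradedTor (symPow k (𝓑 d)) (Sec.isGradedModule 𝓑 d r)
      (ResidueModule k (𝓑 d)) i) :=
  gradedTorDegree (symPow k (𝓑 d)) (Sec.isGradedModule 𝓑 d r) (residueDegree k (𝓑 d)) i j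

end Secant

/-!
The graded pieces of `Tor^{Sym(V)}(M, k)` are computed by the Koszul complex `Λ(V) ⊗ M`: comparing
it with a graded free resolution of `M` by dimension shifting
(`GradedFreeResolution.homologyDegree_eq_bot`) shows that `Tor_i` vanishes in degree `j` as soon as
the Koszul complex is exact there. This uses that the Koszul complex of a free module is exact in
positive homological degrees (`koszul_free_exact`), which in characteristic zero follows from
Euler's formula. It remains to bound the degrees of the Koszul homology of `Sec_{d,r}(B)`
independently of `d`.

All `d` are treated at once. The secant ideals form a family that is stable under the maps
`Sym(B_d) → Sym(B_{e+d})` given by multiplication by elements of `B_e`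
(`isMulStable_secantIdeal`), and nothing else about them is used. Fix a basis of `B_1`, so that
`B_d` is spanned by the monomials of degree `d` in the basis vectors. An element of degree `N` in `Λ^i(B_d) ⊗ Sym(B_d)` is represented by combinations of words with `N`
letters, each letter a monomial of degree `d`; `i` of the letters carry the marks `1, …, i` and
belong to the exterior factor, the others are unmarked. Two operations act on words: letterwise
multiplication by an arbitrary list of `N` monomials of equal degree, which raises `d`, and
insertion of an unmarked letter, which raises `N`. Higman's lemma over Dickson's lemma, applied to
leading words, shows that a family of spaces of words that is stable under both operations is
generated by insertions once `N` is large, uniformly in `d` (`IsStableFamily.exists_bound`).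

This is applied to the combinations of words all of whose letterwise multiples are Koszul cycles.
They form a stable family (`isStableFamily_cyclesFamily`). Every Koszul cycle `z` is represented by
such a combination (`exists_mem_cyclesFamily_wordMap_eq`): average a representative over all
permutations of the positions. Letterwise multiplication of the average is a symmetrized value of
the multilinear map whose diagonal values are the products `u · z` for `u ∈ B_e`; these are cycles,
and by polarization so are the symmetrized values. Finally, an insertion of a letter `v` into a
cycle is the product of that cycle with `v`, which is the boundary of `v ∧ z` because multiplication
by `v` is homotopic to zero on the Koszul complex. So for large `N` every cycle is a boundary.
-/

set_option linter.unusedSectionVars false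

/-! ### The Koszul complex of a module over a symmetric algebra -/

section Koszul

variable (k : Type u) [Field k] (V : Type v) [AddCommGroup V] [Module k V]
  [FiniteDimensional k V]
  (M : Type w) [AddCommGroup M] [Module k M] [Module (SymmetricAlgebra k V) M]
  [IsScalarTower k (SymmetricAlgebra k V) M]

/-- The total space `Λ(V) ⊗ M` of the Koszul complex of a `Sym(V)`-module `M`. -/
abbrev KoszulSpace : Type (max u v w) := ExteriorAlgebra k V ⊗[k] M

/-- The Koszul differential on `Λ(V) ⊗ M`. In terms of a basis `x_c` of `V` with dual basis `ξ_c`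
it is `∑ c, (contraction by ξ_c) ⊗ (multiplication by x_c)`. -/
noncomputable def koszulD : KoszulSpace k V M →ₗ[k] KoszulSpace k V M :=
  ∑ c, TensorProduct.map
    (CliffordAlgebra.contractLeft (Q := (0 : QuadraticForm k V)) ((Module.finBasis k V).coord c))
    (Algebra.lsmul k k M (SymmetricAlgebra.ι k V (Module.finBasis k V c)))

variable {V}

/-- Exterior multiplication by `v` on `Λ(V) ⊗ M`. -/
noncomputable def koszulWedge (v : V) : KoszulSpace k V M →ₗ[k] KoszulSpace k V M :=
  LinearMap.rTensor M (LinearMap.mulLeft k (ExteriorAlgebra.ι k v))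

/-- Multiplication by `s` on the second factor of `Λ(V) ⊗ M`. -/
noncomputable def koszulSMul (s : SymmetricAlgebra k V) :
    KoszulSpace k V M →ₗ[k] KoszulSpace k V M :=
  LinearMap.lTensor (ExteriorAlgebra k V) (Algebra.lsmul k k M s)

variable {k M}

@[simp]
lemma koszulWedge_tmul (v : V) (ω : ExteriorAlgebra k V) (x : M) :
    koszulWedge k M v (ω ⊗ₜ x) = (ExteriorAlgebra.ι k v * ω) ⊗ₜ x := rfl

@[simp]
lemma koszulSMul_tmul (s : SymmetricAlgebra k V) (ω : ExteriorAlgebra k V) (x : M) :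
    koszulSMul k M s (ω ⊗ₜ x) = ω ⊗ₜ (s • x) := rfl

lemma koszulD_tmul (ω : ExteriorAlgebra k V) (x : M) :
    koszulD k V M (ω ⊗ₜ x) = ∑ c,
      (CliffordAlgebra.contractLeft (Q := (0 : QuadraticForm k V))
        ((Module.finBasis k V).coord c) ω) ⊗ₜ
      (SymmetricAlgebra.ι k V (Module.finBasis k V c) • x) := by
  simp [koszulD, LinearMap.sum_apply]

@[simp]
lemma koszulD_algebraMap_tmul (r : k) (x : M) :
    koszulD k V M (algebraMap k (ExteriorAlgebra k V) r ⊗ₜ x) = 0 := by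
  rw [koszulD_tmul]
  refine Finset.sum_eq_zero fun c _ => ?_
  have h := CliffordAlgebra.contractLeft_algebraMap (Q := (0 : QuadraticForm k V))
    ((Module.finBasis k V).coord c) r
  exact (congrArg (fun t => t ⊗ₜ _) h).trans (TensorProduct.zero_tmul _ _)

lemma koszulD_ι_mul_tmul (v : V) (ω : ExteriorAlgebra k V) (x : M) :
    koszulD k V M ((ExteriorAlgebra.ι k v * ω) ⊗ₜ x) =
      ω ⊗ₜ (SymmetricAlgebra.ι k V v • x) - koszulWedge k M v (koszulD k V M (ω ⊗ₜ x)) := by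
  have h := fun c => CliffordAlgebra.contractLeft_ι_mul (Q := (0 : QuadraticForm k V))
    ((Module.finBasis k V).coord c) v ω
  rw [koszulD_tmul, koszulD_tmul, map_sum]
  calc _ = ∑ c, (((Module.finBasis k V).coord c v • ω) ⊗ₜ[k]
        (SymmetricAlgebra.ι k V (Module.finBasis k V c) • x) -
        koszulWedge k M v ((CliffordAlgebra.contractLeft (Q := (0 : QuadraticForm k V))
        ((Module.finBasis k V).coord c) ω) ⊗ₜ
        (SymmetricAlgebra.ι k V (Module.finBasis k V c) • x))) :=
        Finset.sum_congr rfl fun c _ => by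
          rw [koszulWedge_tmul, ← TensorProduct.sub_tmul]
          exact congrArg (fun t => t ⊗ₜ _) (h c)
    _ = _ := by
      rw [Finset.sum_sub_distrib]
      congr 1
      simp_rw [TensorProduct.smul_tmul, ← smul_assoc, ← map_smul]
      rw [← TensorProduct.tmul_sum, ← Finset.sum_smul, ← map_sum]
      simp only [Module.Basis.coord_apply, Module.Basis.sum_repr]

/-- Cartan's formula: exterior multiplication by `v` is a contracting homotopy for multiplication
by `v`. -/
lemma koszulD_wedge (v : V) (z : KoszulSpace k V M) :
    koszulD k V M (koszulWedge k M v z) =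
      koszulSMul k M (SymmetricAlgebra.ι k V v) z - koszulWedge k M v (koszulD k V M z) := by
  induction z using TensorProduct.induction_on with
  | zero => simp
  | add x y hx hy => simp only [map_add, hx, hy]; abel
  | tmul ω x => exact koszulD_ι_mul_tmul v ω x

lemma koszulD_smul (s : SymmetricAlgebra k V) (z : KoszulSpace k V M) :
    koszulD k V M (koszulSMul k M s z) = koszulSMul k M s (koszulD k V M z) := by
  induction z using TensorProduct.induction_on with
  | zero => simp
  | add x y hx hy => simp only [map_add, hx, hy]
  | tmul ω x => simp [koszulD_tmul, smul_smul, mul_comm]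

lemma koszulSpace_induction {P : KoszulSpace k V M → Prop} (add : ∀ x y, P x → P y → P (x + y))
    (one : ∀ (r : k) (x : M), P (algebraMap k (ExteriorAlgebra k V) r ⊗ₜ x))
    (wedge : ∀ (v : V) ω (x : M), P (ω ⊗ₜ x) → P (koszulWedge k M v (ω ⊗ₜ x))) (z) : P z := by
  induction z using TensorProduct.induction_on with
  | zero => simpa using one 0 0
  | add x y hx hy => exact add _ _ hx hy
  | tmul ω x =>
    induction ω using CliffordAlgebra.left_induction with
    | algebraMap r => exact one r x
    | add a b ha hb => rw [TensorProduct.add_tmul]; exact add _ _ ha hb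
    | ι_mul a v ha => exact wedge v a x ha

lemma koszulD_koszulD (z : KoszulSpace k V M) : koszulD k V M (koszulD k V M z) = 0 := by
  induction z using koszulSpace_induction with
  | add x y hx hy => simp [hx, hy]
  | one r x => simp
  | wedge v ω x h => rw [koszulD_wedge, map_sub, koszulD_wedge, h, koszulD_smul]; simp

/-- The Koszul differential commutes with the maps induced by a linear map `f : V → W` and an
`f`-semilinear map of modules. -/
lemma koszulD_map {W : Type*} [AddCommGroup W] [Module k W] [FiniteDimensional k W]
    {N : Type*} [AddCommGroup N] [Module k N] [Module (SymmetricAlgebra k W) N]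
    [IsScalarTower k (SymmetricAlgebra k W) N] (f : V →ₗ[k] W) (g : M →ₗ[k] N)
    (hg : ∀ v x, g (SymmetricAlgebra.ι k V v • x) = SymmetricAlgebra.ι k W (f v) • g x)
    (z : KoszulSpace k V M) :
    koszulD k W N (TensorProduct.map (ExteriorAlgebra.map f).toLinearMap g z) =
      TensorProduct.map (ExteriorAlgebra.map f).toLinearMap g (koszulD k V M z) := by
  have hw : ∀ v z, TensorProduct.map (ExteriorAlgebra.map f).toLinearMap g (koszulWedge k M v z) =
      koszulWedge k N (f v) (TensorProduct.map (ExteriorAlgebra.map f).toLinearMap g z) := by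
    intro v z
    induction z using TensorProduct.induction_on with
    | zero => simp
    | add x y hx hy => simp only [map_add, hx, hy]
    | tmul ω x => simp
  have hs : ∀ v z, TensorProduct.map (ExteriorAlgebra.map f).toLinearMap g
      (koszulSMul k M (SymmetricAlgebra.ι k V v) z) = koszulSMul k N (SymmetricAlgebra.ι k W (f v))
        (TensorProduct.map (ExteriorAlgebra.map f).toLinearMap g z) := by
    intro v z
    induction z using TensorProduct.induction_on with
    | zero => simp
    | add x y hx hy => simp only [map_add, hx, hy]
    | tmul ω x => simp [hg]
  induction z using koszulSpace_induction with
  | add x y hx hy => simp only [map_add, hx, hy]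
  | one r x => simp
  | wedge v ω x h => rw [hw, koszulD_wedge, koszulD_wedge, h, map_sub, hs, hw]

variable (k V) in
/-- The part of `Λ(V) ⊗ M` of homological degree `i` and total internal degree `j`, for the
family `ℳ` of graded pieces of `M`: the span of `Λ^i(V) ⊗ ℳ b` with `i + b = j`. -/
noncomputable def koszulDegree (ℳ : ℕ → Submodule k M) (i j : ℕ) :
    Submodule k (KoszulSpace k V M) :=
  Submodule.span k {t | ∃ b, i + b = j ∧ ∃ ω ∈ ⋀[k]^i V, ∃ x ∈ ℳ b, t = ω ⊗ₜ x}

lemma tmul_mem_koszulDegree {ℳ : ℕ → Submodule k M} {i j b : ℕ} (h : i + b = j)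
    {ω : ExteriorAlgebra k V} (hω : ω ∈ ⋀[k]^i V) {x : M} (hx : x ∈ ℳ b) :
    ω ⊗ₜ x ∈ koszulDegree k V ℳ i j :=
  Submodule.subset_span ⟨b, h, ω, hω, x, hx, rfl⟩

/-- A map that is linear on the second factor and preserves degrees preserves the graded pieces of
the Koszul complex. -/
lemma lTensor_mem_koszulDegree {ℳ : ℕ → Submodule k M}
    {N : Type*} [AddCommGroup N] [Module k N] [Module (SymmetricAlgebra k V) N]
    [IsScalarTower k (SymmetricAlgebra k V) N] {𝒩 : ℕ → Submodule k N} (g : M →ₗ[k] N)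
    {i j i' j' : ℕ} (hi : i = i')
    (hg : ∀ b, i + b = j → ∀ x ∈ ℳ b, ∃ b', i' + b' = j' ∧ g x ∈ 𝒩 b') {z : KoszulSpace k V M}
    (hz : z ∈ koszulDegree k V ℳ i j) :
    LinearMap.lTensor (ExteriorAlgebra k V) g z ∈ koszulDegree k V 𝒩 i' j' := by
  subst hi
  induction hz using Submodule.span_induction with
  | zero => simp
  | add x y _ _ hx hy => rw [map_add]; exact add_mem hx hy
  | smul c x _ hx => rw [map_smul]; exact Submodule.smul_mem _ _ hx
  | mem t ht =>
    obtain ⟨b, h, ω, hω, x, hx, rfl⟩ := ht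
    obtain ⟨b', h', hx'⟩ := hg b h x hx
    rw [LinearMap.lTensor_tmul]
    exact tmul_mem_koszulDegree h' hω hx'

lemma koszulWedge_mem_koszulDegree {ℳ : ℕ → Submodule k M} {i j : ℕ} (v : V)
    {z : KoszulSpace k V M} (hz : z ∈ koszulDegree k V ℳ i j) :
    koszulWedge k M v z ∈ koszulDegree k V ℳ (i + 1) (j + 1) := by
  induction hz using Submodule.span_induction with
  | zero => simp
  | add x y _ _ hx hy => rw [map_add]; exact add_mem hx hy
  | smul c x _ hx => rw [map_smul]; exact Submodule.smul_mem _ _ hx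
  | mem t ht =>
    obtain ⟨b, h, ω, hω, x, hx, rfl⟩ := ht
    rw [koszulWedge_tmul]
    refine tmul_mem_koszulDegree (by omega) ?_ hx
    rw [ExteriorAlgebra.exteriorPower, pow_succ']
    exact Submodule.mul_mem_mul ⟨v, rfl⟩ hω

lemma exists_eq_one_tmul_of_mem_koszulDegree {ℳ : ℕ → Submodule k M} {j : ℕ} {z : KoszulSpace k V M}
    (hz : z ∈ koszulDegree k V ℳ 0 j) : ∃ x ∈ ℳ j, z = 1 ⊗ₜ x := by
  induction hz using Submodule.span_induction with
  | zero => exact ⟨0, zero_mem _, by simp⟩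
  | add x y _ _ hx hy =>
    obtain ⟨a, ha, rfl⟩ := hx
    obtain ⟨b, hb, rfl⟩ := hy
    exact ⟨a + b, add_mem ha hb, by rw [TensorProduct.tmul_add]⟩
  | smul c x _ hx =>
    obtain ⟨a, ha, rfl⟩ := hx
    exact ⟨c • a, Submodule.smul_mem _ _ ha, by rw [TensorProduct.tmul_smul]⟩
  | mem t ht =>
    obtain ⟨b, h, ω, hω, x, hx, rfl⟩ := ht
    obtain rfl : b = j := by omega
    rw [ExteriorAlgebra.exteriorPower, pow_zero, Submodule.mem_one] at hω
    obtain ⟨r, rfl⟩ := hω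
    refine ⟨r • x, Submodule.smul_mem _ _ hx, ?_⟩
    rw [Algebra.algebraMap_eq_smul_one, TensorProduct.smul_tmul]

variable (k V) in
/-- Koszul homology `H_i(Λ(V) ⊗ M)` vanishes in total internal degree `j`: every cycle is the
boundary of an element of the same internal degree. -/
def KoszulVanishes (ℳ : ℕ → Submodule k M) (i j : ℕ) : Prop :=
  ∀ z ∈ koszulDegree k V ℳ i j, koszulD k V M z = 0 →
    ∃ y ∈ koszulDegree k V ℳ (i + 1) j, koszulD k V M y = z

end Koszul

/-! ### Exactness of the Koszul complex of a free module -/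

section Exact

variable {k : Type u} [Field k] {V : Type v} [AddCommGroup V] [Module k V]
  [FiniteDimensional k V]

variable (k V) in
/-- The partial derivative of `Sym(V)` with respect to the `c`-th basis vector of `V`. -/
noncomputable def symDeriv (c : Fin (Module.finrank k V)) :
    SymmetricAlgebra k V →ₗ[k] SymmetricAlgebra k V :=
  (SymmetricAlgebra.equivMvPolynomial (Module.finBasis k V)).symm.toLinearMap ∘ₗ
    (MvPolynomial.pderiv c).toLinearMap ∘ₗ
    (SymmetricAlgebra.equivMvPolynomial (Module.finBasis k V)).toLinearMap

lemma symDeriv_mul (c : Fin (Module.finrank k V)) (s t : SymmetricAlgebra k V) :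
    symDeriv k V c (s * t) = s * symDeriv k V c t + t * symDeriv k V c s := by
  simp [symDeriv, Derivation.leibniz]

lemma symDeriv_algebraMap (c : Fin (Module.finrank k V)) (r : k) :
    symDeriv k V c (algebraMap k _ r) = 0 := by
  simp [symDeriv]

lemma symDeriv_ι (c : Fin (Module.finrank k V)) (v : V) :
    symDeriv k V c (SymmetricAlgebra.ι k V v) =
      algebraMap k _ ((Module.finBasis k V).coord c v) := by
  classical
  refine LinearMap.congr_fun (f := symDeriv k V c ∘ₗ SymmetricAlgebra.ι k V)
    (g := Algebra.linearMap k _ ∘ₗ (Module.finBasis k V).coord c)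
    ((Module.finBasis k V).ext fun c' => ?_) v
  by_cases h : c' = c
  · subst h; simp [symDeriv]
  · simp [symDeriv, MvPolynomial.pderiv_X_of_ne h, Finsupp.single_eq_of_ne' h]

lemma symDeriv_ι_mul (c : Fin (Module.finrank k V)) (v : V) (s : SymmetricAlgebra k V) :
    symDeriv k V c (SymmetricAlgebra.ι k V v * s) =
      (Module.finBasis k V).coord c v • s + SymmetricAlgebra.ι k V v * symDeriv k V c s := by
  rw [symDeriv_mul, symDeriv_ι, add_comm, mul_comm s, ← Algebra.smul_def]

lemma symDeriv_mem (c : Fin (Module.finrank k V)) {a : ℕ} {s : SymmetricAlgebra k V}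
    (hs : s ∈ symPow k V (a + 1)) : symDeriv k V c s ∈ symPow k V a := by
  unfold symPow at hs ⊢
  suffices h : ∀ n, ∀ s ∈ LinearMap.range (SymmetricAlgebra.ι k V) ^ n,
      ∀ a, n = a + 1 → symDeriv k V c s ∈ LinearMap.range (SymmetricAlgebra.ι k V) ^ a from
    h _ s hs a rfl
  intro n s hs
  induction hs using Submodule.pow_induction_on_left' with
  | algebraMap r => intro a ha; omega
  | add x y i hx hy ihx ihy => intro a ha; rw [map_add]; exact add_mem (ihx a ha) (ihy a ha)
  | mem_mul m hm i x hx ih =>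
    intro a ha
    obtain rfl : i = a := by omega
    obtain ⟨v, rfl⟩ := hm
    rw [symDeriv_ι_mul]
    refine add_mem (Submodule.smul_mem _ _ hx) ?_
    cases i with
    | zero =>
      rw [pow_zero, Submodule.mem_one] at hx
      obtain ⟨r, rfl⟩ := hx
      rw [symDeriv_algebraMap, mul_zero]
      exact zero_mem _
    | succ i =>
      rw [pow_succ']
      exact Submodule.mul_mem_mul ⟨v, rfl⟩ (ih i rfl)

/-- Euler's formula for homogeneous elements of the symmetric algebra. -/
lemma sum_ι_mul_symDeriv {a : ℕ} {s : SymmetricAlgebra k V} (hs : s ∈ symPow k V a) :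
    ∑ c, SymmetricAlgebra.ι k V (Module.finBasis k V c) * symDeriv k V c s = (a : k) • s := by
  unfold symPow at hs
  induction hs using Submodule.pow_induction_on_left' with
  | algebraMap r => simp [symDeriv_algebraMap]
  | add x y i hx hy ihx ihy =>
    simp only [map_add, mul_add, Finset.sum_add_distrib, ihx, ihy, smul_add]
  | mem_mul m hm i x hx ih =>
    obtain ⟨v, rfl⟩ := hm
    simp only [symDeriv_ι_mul, mul_add, Finset.sum_add_distrib]
    have h1 : ∑ c, SymmetricAlgebra.ι k V (Module.finBasis k V c) *
        ((Module.finBasis k V).coord c v • x) = SymmetricAlgebra.ι k V v * x := by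
      simp_rw [mul_smul_comm, ← smul_mul_assoc, ← map_smul]
      rw [← Finset.sum_mul, ← map_sum]
      simp only [Module.Basis.coord_apply, Module.Basis.sum_repr]
    have h2 : ∑ c, SymmetricAlgebra.ι k V (Module.finBasis k V c) *
        (SymmetricAlgebra.ι k V v * symDeriv k V c x) =
          SymmetricAlgebra.ι k V v * ((i : k) • x) := by
      rw [← ih, Finset.mul_sum]
      exact Finset.sum_congr rfl fun c _ => by ring
    rw [h1, h2, mul_smul_comm]
    push_cast
    rw [add_smul, one_smul, add_comm]

/-- Euler's formula for homogeneous elements of the exterior algebra. -/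
lemma sum_ι_mul_contractLeft {i : ℕ} {ω : ExteriorAlgebra k V} (hω : ω ∈ ⋀[k]^i V) :
    ∑ c, ExteriorAlgebra.ι k (Module.finBasis k V c) *
      CliffordAlgebra.contractLeft (Q := (0 : QuadraticForm k V))
        ((Module.finBasis k V).coord c) ω = (i : k) • ω := by
  unfold ExteriorAlgebra.exteriorPower at hω
  induction hω using Submodule.pow_induction_on_left' with
  | algebraMap r =>
    rw [Nat.cast_zero, zero_smul]
    refine Finset.sum_eq_zero fun c _ => ?_
    exact (congrArg (fun t => ExteriorAlgebra.ι k (Module.finBasis k V c) * t)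
      (CliffordAlgebra.contractLeft_algebraMap (Q := (0 : QuadraticForm k V)) _ r)).trans
      (mul_zero _)
  | add x y i hx hy ihx ihy =>
    simp only [map_add, mul_add, Finset.sum_add_distrib, ihx, ihy, smul_add]
  | mem_mul m hm i x hx ih =>
    obtain ⟨v, rfl⟩ := hm
    have h := fun c => CliffordAlgebra.contractLeft_ι_mul (Q := (0 : QuadraticForm k V))
      ((Module.finBasis k V).coord c) v x
    have h1 : ∑ c, ExteriorAlgebra.ι k (Module.finBasis k V c) *
        ((Module.finBasis k V).coord c v • x) = ExteriorAlgebra.ι k v * x := by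
      simp_rw [mul_smul_comm, ← smul_mul_assoc, ← map_smul]
      rw [← Finset.sum_mul, ← map_sum]
      simp only [Module.Basis.coord_apply, Module.Basis.sum_repr]
    calc _ = ∑ c, (ExteriorAlgebra.ι k (Module.finBasis k V c) *
          ((Module.finBasis k V).coord c v • x) + ExteriorAlgebra.ι k v *
          (ExteriorAlgebra.ι k (Module.finBasis k V c) *
          CliffordAlgebra.contractLeft (Q := (0 : QuadraticForm k V))
          ((Module.finBasis k V).coord c) x)) := by
          refine Finset.sum_congr rfl fun c _ => ?_
          refine (congrArg (fun t => ExteriorAlgebra.ι k (Module.finBasis k V c) * t)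
            (h c)).trans ?_
          have hc : ExteriorAlgebra.ι k (Module.finBasis k V c) * ExteriorAlgebra.ι k v =
              - (ExteriorAlgebra.ι k v * ExteriorAlgebra.ι k (Module.finBasis k V c)) :=
            eq_neg_of_add_eq_zero_left (ExteriorAlgebra.ι_add_mul_swap _ _)
          rw [mul_sub, sub_eq_add_neg, ← mul_assoc, ← mul_assoc, ← neg_mul]
          congr 2
          rw [← neg_eq_iff_eq_neg] at hc
          exact hc
      _ = _ := by
        rw [Finset.sum_add_distrib, h1, ← Finset.mul_sum, ih, mul_smul_comm]
        push_cast
        rw [add_smul, one_smul, add_comm]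

end Exact

section Exact

variable {k : Type u} [Field k] {V : Type v} [AddCommGroup V] [Module k V]
  [FiniteDimensional k V]

lemma contractLeft_mem_exteriorPower (ξ : Module.Dual k V) {i : ℕ} {ω : ExteriorAlgebra k V}
    (hω : ω ∈ ⋀[k]^(i + 1) V) :
    CliffordAlgebra.contractLeft (Q := (0 : QuadraticForm k V)) ξ ω ∈ ⋀[k]^i V := by
  unfold ExteriorAlgebra.exteriorPower at hω ⊢
  suffices h : ∀ n, ∀ ω ∈ LinearMap.range (ExteriorAlgebra.ι k (M := V)) ^ n, ∀ i, n = i + 1 →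
      CliffordAlgebra.contractLeft (Q := (0 : QuadraticForm k V)) ξ ω ∈
        LinearMap.range (ExteriorAlgebra.ι k (M := V)) ^ i from h _ ω hω i rfl
  intro n ω hω
  induction hω using Submodule.pow_induction_on_left' with
  | algebraMap r => intro i hi; omega
  | add x y i hx hy ihx ihy => intro a ha; rw [map_add]; exact add_mem (ihx a ha) (ihy a ha)
  | mem_mul m hm i x hx ih =>
    intro a ha
    obtain rfl : i = a := by omega
    obtain ⟨v, rfl⟩ := hm
    have h := CliffordAlgebra.contractLeft_ι_mul (Q := (0 : QuadraticForm k V)) ξ v x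
    refine (congrArg (· ∈ LinearMap.range (ExteriorAlgebra.ι k (M := V)) ^ i) h).mpr ?_
    refine sub_mem (Submodule.smul_mem _ _ hx) ?_
    cases i with
    | zero =>
      rw [pow_zero, Submodule.mem_one] at hx
      obtain ⟨r, rfl⟩ := hx
      have h0 := CliffordAlgebra.contractLeft_algebraMap (Q := (0 : QuadraticForm k V)) ξ r
      have h1 : (CliffordAlgebra.ι (0 : QuadraticForm k V)) v *
          CliffordAlgebra.contractLeft (Q := (0 : QuadraticForm k V)) ξ
            (algebraMap k (ExteriorAlgebra k V) r) = 0 :=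
        (congrArg (fun t => (CliffordAlgebra.ι (0 : QuadraticForm k V)) v * t) h0).trans
          (mul_zero _)
      exact (congrArg (· ∈ LinearMap.range (ExteriorAlgebra.ι k (M := V)) ^ 0) h1).mpr
        (zero_mem _)
    | succ i =>
      rw [pow_succ']
      exact Submodule.mul_mem_mul ⟨v, rfl⟩ (ih i rfl)

variable (k V) in
/-- The de Rham differential `∑ c, (x_c ∧ ·) ⊗ ∂_c` on `Λ(V) ⊗ Sym(V)`. -/
noncomputable def koszulHomotopy :
    KoszulSpace k V (SymmetricAlgebra k V) →ₗ[k] KoszulSpace k V (SymmetricAlgebra k V) :=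
  ∑ c, TensorProduct.map (LinearMap.mulLeft k (ExteriorAlgebra.ι k (Module.finBasis k V c)))
    (symDeriv k V c)

lemma koszulHomotopy_tmul (ω : ExteriorAlgebra k V) (s : SymmetricAlgebra k V) :
    koszulHomotopy k V (ω ⊗ₜ s) =
      ∑ c, (ExteriorAlgebra.ι k (Module.finBasis k V c) * ω) ⊗ₜ symDeriv k V c s := by
  simp [koszulHomotopy, LinearMap.sum_apply]

lemma koszulD_homotopy_tmul {i a : ℕ} {ω : ExteriorAlgebra k V} (hω : ω ∈ ⋀[k]^i V)
    {s : SymmetricAlgebra k V} (hs : s ∈ symPow k V a) :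
    koszulD k V _ (koszulHomotopy k V (ω ⊗ₜ s)) + koszulHomotopy k V (koszulD k V _ (ω ⊗ₜ s)) =
      ((i + a : ℕ) : k) • (ω ⊗ₜ[k] s) := by
  classical
  have h1 : koszulD k V _ (koszulHomotopy k V (ω ⊗ₜ s)) = (a : k) • (ω ⊗ₜ[k] s) -
      ∑ c, koszulWedge k _ (Module.finBasis k V c)
        (koszulD k V _ (ω ⊗ₜ symDeriv k V c s)) := by
    rw [koszulHomotopy_tmul, map_sum]
    simp_rw [koszulD_ι_mul_tmul, smul_eq_mul]
    rw [Finset.sum_sub_distrib, ← TensorProduct.tmul_sum, sum_ι_mul_symDeriv hs,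
      TensorProduct.tmul_smul]
  have h2 : koszulHomotopy k V (koszulD k V _ (ω ⊗ₜ s)) = (i : k) • (ω ⊗ₜ[k] s) +
      ∑ c, koszulWedge k _ (Module.finBasis k V c)
        (koszulD k V _ (ω ⊗ₜ symDeriv k V c s)) := by
    rw [koszulD_tmul, map_sum]
    simp_rw [koszulHomotopy_tmul, smul_eq_mul, symDeriv_ι_mul, TensorProduct.tmul_add]
    simp_rw [Finset.sum_add_distrib]
    congr 1
    · rw [Finset.sum_comm]
      rw [TensorProduct.smul_tmul', ← sum_ι_mul_contractLeft hω, TensorProduct.sum_tmul]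
      refine Finset.sum_congr rfl fun c _ => ?_
      rw [Finset.sum_eq_single c]
      · simp
      · intro c' _ hc
        simp [Finsupp.single_eq_of_ne' hc]
      · simp
    · rw [Finset.sum_comm]
      simp_rw [koszulD_tmul, map_sum, koszulWedge_tmul, smul_eq_mul]
  rw [h1, h2]
  push_cast
  rw [add_smul]
  abel

/-- Homotopy formula: the anticommutator of the Koszul and de Rham differentials is multiplication
by the total internal degree. -/
lemma koszulD_homotopy {i j : ℕ} {z : KoszulSpace k V (SymmetricAlgebra k V)}
    (hz : z ∈ koszulDegree k V (symPow k V) i j) :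
    koszulD k V _ (koszulHomotopy k V z) + koszulHomotopy k V (koszulD k V _ z) =
      (j : k) • z := by
  induction hz using Submodule.span_induction with
  | zero => simp
  | add x y _ _ hx hy => rw [smul_add, ← hx, ← hy]; simp only [map_add]; abel
  | smul c x _ hx => rw [smul_comm, ← hx]; simp only [map_smul, smul_add]
  | mem t ht =>
    obtain ⟨b, rfl, ω, hω, x, hx, rfl⟩ := ht
    exact koszulD_homotopy_tmul hω hx

lemma koszulHomotopy_mem {i j : ℕ} {z : KoszulSpace k V (SymmetricAlgebra k V)}
    (hz : z ∈ koszulDegree k V (symPow k V) i j) :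
    koszulHomotopy k V z ∈ koszulDegree k V (symPow k V) (i + 1) j := by
  induction hz using Submodule.span_induction with
  | zero => simp
  | add x y _ _ hx hy => rw [map_add]; exact add_mem hx hy
  | smul c x _ hx => rw [map_smul]; exact Submodule.smul_mem _ _ hx
  | mem t ht =>
    obtain ⟨b, rfl, ω, hω, x, hx, rfl⟩ := ht
    rw [koszulHomotopy_tmul]
    refine sum_mem fun c _ => ?_
    cases b with
    | zero =>
      unfold symPow at hx
      rw [pow_zero, Submodule.mem_one] at hx
      obtain ⟨r, rfl⟩ := hx
      simp [symDeriv_algebraMap]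
    | succ b =>
      refine tmul_mem_koszulDegree (b := b) (by omega) ?_ (symDeriv_mem c hx)
      rw [ExteriorAlgebra.exteriorPower, pow_succ']
      exact Submodule.mul_mem_mul ⟨_, rfl⟩ hω

section Linear

variable {M : Type*} [AddCommGroup M] [Module k M] [Module (SymmetricAlgebra k V) M]
  [IsScalarTower k (SymmetricAlgebra k V) M]
  {N : Type*} [AddCommGroup N] [Module k N] [Module (SymmetricAlgebra k V) N]
  [IsScalarTower k (SymmetricAlgebra k V) N]

/-- The Koszul differential is natural for `Sym(V)`-linear maps. -/
lemma koszulD_lTensor (g : M →ₗ[SymmetricAlgebra k V] N) (z : KoszulSpace k V M) :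
    koszulD k V N (LinearMap.lTensor _ (g.restrictScalars k) z) =
      LinearMap.lTensor _ (g.restrictScalars k) (koszulD k V M z) := by
  induction z using TensorProduct.induction_on with
  | zero => simp
  | add x y hx hy => simp only [map_add, hx, hy]
  | tmul ω x => simp [koszulD_tmul]

lemma lTensor_lTensor {X Y Z : Type*} [AddCommGroup X] [Module k X] [AddCommGroup Y] [Module k Y]
    [AddCommGroup Z] [Module k Z] (f : Y →ₗ[k] Z) (g : X →ₗ[k] Y)
    (z : ExteriorAlgebra k V ⊗[k] X) :
    LinearMap.lTensor _ f (LinearMap.lTensor _ g z) = LinearMap.lTensor _ (f ∘ₗ g) z :=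
  (LinearMap.lTensor_comp_apply _ f g z).symm

lemma one_tmul_injective : Function.Injective fun x : M => (1 : ExteriorAlgebra k V) ⊗ₜ[k] x := by
  intro x y h
  have := congrArg (fun z => TensorProduct.lid k M
    (LinearMap.rTensor M (ExteriorAlgebra.algebraMapInv (R := k) (M := V)).toLinearMap z)) h
  simpa using this

lemma koszulD_zero_degree {ℳ : ℕ → Submodule k M} {j : ℕ} {z : KoszulSpace k V M}
    (hz : z ∈ koszulDegree k V ℳ 0 j) : koszulD k V M z = 0 := by
  obtain ⟨x, -, rfl⟩ := exists_eq_one_tmul_of_mem_koszulDegree hz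
  rw [← map_one (algebraMap k (ExteriorAlgebra k V)), koszulD_algebraMap_tmul]

lemma koszulD_mem_koszulDegree {ℳ : ℕ → Submodule k M}
    (hℳ : ∀ b, ∀ s ∈ symPow k V 1, ∀ x ∈ ℳ b, s • x ∈ ℳ (b + 1)) {i j : ℕ}
    {z : KoszulSpace k V M} (hz : z ∈ koszulDegree k V ℳ (i + 1) j) :
    koszulD k V M z ∈ koszulDegree k V ℳ i j := by
  induction hz using Submodule.span_induction with
  | zero => simp
  | add x y _ _ hx hy => rw [map_add]; exact add_mem hx hy
  | smul c x _ hx => rw [map_smul]; exact Submodule.smul_mem _ _ hx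
  | mem t ht =>
    obtain ⟨b, rfl, ω, hω, x, hx, rfl⟩ := ht
    rw [koszulD_tmul]
    exact sum_mem fun c _ => tmul_mem_koszulDegree (b := b + 1) (by omega)
      (contractLeft_mem_exteriorPower _ hω) (hℳ b _ (ι_mem_symPow k V _) x hx)

end Linear

/-- The elements of the free module `G →₀ Sym(V)` with all coordinates in `Sym(V)₊`. -/
def VanishesAtOrigin {G : Type*} (f : G →₀ SymmetricAlgebra k V) : Prop :=
  ∀ g, SymmetricAlgebra.algebraMapInv (f g) = 0

/-- Boundaries of homological degree `0` have coefficients in `Sym(V)₊`. -/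
lemma vanishesAtOrigin_of_koszulD {G : Type*} (y : KoszulSpace k V (G →₀ SymmetricAlgebra k V))
    {x : G →₀ SymmetricAlgebra k V} (h : koszulD k V _ y = 1 ⊗ₜ x) : VanishesAtOrigin x := by
  intro g
  let ε : (G →₀ SymmetricAlgebra k V) →ₗ[k] k :=
    (SymmetricAlgebra.algebraMapInv (R := k) (M := V)).toLinearMap ∘ₗ Finsupp.lapply g
  have h0 : ∀ y : KoszulSpace k V (G →₀ SymmetricAlgebra k V),
      LinearMap.lTensor _ ε (koszulD k V _ y) = 0 := by
    intro y
    induction y using TensorProduct.induction_on with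
    | zero => simp
    | add x y hx hy => simp only [map_add, hx, hy, add_zero]
    | tmul ω x =>
      rw [koszulD_tmul, map_sum]
      refine Finset.sum_eq_zero fun c _ => ?_
      rw [LinearMap.lTensor_tmul]
      simp [ε, SymmetricAlgebra.algebraMapInv_ι]
  have h1 := h0 y
  rw [h, LinearMap.lTensor_tmul] at h1
  have h2 := congrArg (fun z => TensorProduct.lid k k
    (LinearMap.rTensor k (ExteriorAlgebra.algebraMapInv (R := k) (M := V)).toLinearMap z)) h1
  simpa [ε] using h2

/-- An element of `Λ(V) ⊗ (G →₀ Sym(V))` is the sum of its components, all but finitely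
many of which vanish. -/
lemma exists_finset_sum_components {G : Type*} (z : KoszulSpace k V (G →₀ SymmetricAlgebra k V)) :
    ∃ s : Finset G, ∀ t, s ⊆ t → z = ∑ g ∈ t,
      LinearMap.lTensor _ (Finsupp.lsingle g ∘ₗ Finsupp.lapply g) z := by
  classical
  induction z using TensorProduct.induction_on with
  | zero => exact ⟨∅, fun t _ => by simp⟩
  | add x y hx hy =>
    obtain ⟨s, hs⟩ := hx
    obtain ⟨s', hs'⟩ := hy
    refine ⟨s ∪ s', fun t ht => ?_⟩
    simp_rw [map_add]
    rw [Finset.sum_add_distrib, ← hs t (Finset.union_subset_left ht),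
      ← hs' t (Finset.union_subset_right ht)]
  | tmul ω x =>
    refine ⟨x.support, fun t ht => ?_⟩
    simp_rw [LinearMap.lTensor_tmul]
    rw [← TensorProduct.tmul_sum]
    congr 1
    simp only [LinearMap.comp_apply, Finsupp.lapply_apply, Finsupp.lsingle_apply]
    conv_lhs => rw [← x.sum_single]
    exact Finset.sum_subset ht fun g _ hg => by simp [Finsupp.notMem_support_iff.1 hg]

/-- The Koszul complex of a graded free module is exact in positive homological degrees, and an
element of homological degree `0` with coefficients in `Sym(V)₊` is a boundary. On the coordinate
of the basis vector `g` the homotopy formula holds with the factor `j - deg g`, which is invertible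
in characteristic zero unless it is `0`. -/
lemma koszul_free_exact [CharZero k] {G : Type*} (deg : G → ℕ) {i j : ℕ}
    {z : KoszulSpace k V (G →₀ SymmetricAlgebra k V)}
    (hz : z ∈ koszulDegree k V (freeDegree (symPow k V) deg) i j) (hD : koszulD k V _ z = 0)
    (h0 : i = 0 → ∃ x, VanishesAtOrigin x ∧ z = 1 ⊗ₜ x) :
    ∃ y ∈ koszulDegree k V (freeDegree (symPow k V) deg) (i + 1) j, koszulD k V _ y = z := by
  classical
  obtain ⟨s, hs⟩ := exists_finset_sum_components z
  have key : ∀ g, ∃ y ∈ koszulDegree k V (freeDegree (symPow k V) deg) (i + 1) j,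
      koszulD k V _ y = LinearMap.lTensor _ (Finsupp.lsingle g ∘ₗ Finsupp.lapply g) z := by
    intro g
    set zg : KoszulSpace k V (SymmetricAlgebra k V) :=
      LinearMap.lTensor _ (Finsupp.lapply g) z with hzg
    have hcomp : LinearMap.lTensor _ (Finsupp.lsingle g ∘ₗ Finsupp.lapply g) z =
        LinearMap.lTensor _ (Finsupp.lsingle g) zg := (lTensor_lTensor _ _ z).symm
    rw [hcomp]
    by_cases hg : zg = 0
    · exact ⟨0, zero_mem _, by simp [hg]⟩
    have hDg : koszulD k V _ zg = 0 := by
      have := koszulD_lTensor (Finsupp.lapply (R := SymmetricAlgebra k V) g) z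
      rw [hD, map_zero] at this
      exact this
    by_cases hlt : i + deg g ≤ j
    swap
    -- the coordinate of `g` lies in `Sym` of negative degree
    · refine absurd ?_ hg
      have := lTensor_mem_koszulDegree (𝒩 := fun _ => (⊥ : Submodule k (SymmetricAlgebra k V)))
        (Finsupp.lapply g) (rfl : i = i) (j := j) (j' := j) (fun b hb x hx => ⟨b, hb, by
          rw [Submodule.mem_bot]
          exact (apply_of_mem_freeDegree deg hx g).2 (by omega)⟩) hz
      rw [← hzg, koszulDegree] at this
      have hle : Submodule.span k {t : KoszulSpace k V (SymmetricAlgebra k V) | ∃ b, i + b = j ∧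
          ∃ ω ∈ ⋀[k]^i V, ∃ x ∈ (⊥ : Submodule k (SymmetricAlgebra k V)), t = ω ⊗ₜ x} ≤ ⊥ := by
        rw [Submodule.span_le]
        rintro t ⟨b, -, ω, -, x, hx, rfl⟩
        rw [Submodule.mem_bot] at hx
        simp [hx]
      exact (Submodule.mem_bot k).1 (hle this)
    have hzg' : zg ∈ koszulDegree k V (symPow k V) i (j - deg g) :=
      lTensor_mem_koszulDegree (Finsupp.lapply g) rfl (fun b hb x hx => ⟨b - deg g, by omega,
        (apply_of_mem_freeDegree deg hx g).1 (by omega)⟩) hz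
    have hne : ((j - deg g : ℕ) : k) ≠ 0 := by
      -- in degree `0` the coordinate is a constant, which vanishes by `h0`
      rw [Nat.cast_ne_zero]
      intro hj
      refine hg ?_
      obtain rfl : i = 0 := by omega
      obtain ⟨x, hx, rfl⟩ := h0 rfl
      rw [hj] at hzg'
      obtain ⟨t, ht, ht'⟩ := exists_eq_one_tmul_of_mem_koszulDegree hzg'
      rw [hzg, LinearMap.lTensor_tmul] at ht'
      have h3 := one_tmul_injective ht'
      simp only [Finsupp.lapply_apply] at h3
      unfold symPow at ht
      rw [pow_zero, Submodule.mem_one] at ht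
      obtain ⟨r, rfl⟩ := ht
      have h4 := hx g
      rw [h3, AlgHom.commutes] at h4
      rw [hzg, LinearMap.lTensor_tmul, Finsupp.lapply_apply, h3]
      simp only [Algebra.algebraMap_self, RingHom.id_apply] at h4
      simp [h4]
    refine ⟨LinearMap.lTensor _ (Finsupp.lsingle g)
      (((j - deg g : ℕ) : k)⁻¹ • koszulHomotopy k V zg), ?_, ?_⟩
    · exact lTensor_mem_koszulDegree _ rfl (fun b hb x hx => ⟨b + deg g, by omega,
        single_mem_freeDegree deg g rfl hx⟩)
        (Submodule.smul_mem _ _ (koszulHomotopy_mem hzg'))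
    · have h5 := koszulD_homotopy hzg'
      rw [hDg, map_zero, add_zero] at h5
      have h6 := koszulD_lTensor (Finsupp.lsingle (R := SymmetricAlgebra k V) g)
        (((j - deg g : ℕ) : k)⁻¹ • koszulHomotopy k V zg)
      refine h6.trans ?_
      rw [map_smul, h5, smul_smul, inv_mul_cancel₀ hne, one_smul]
      rfl
  choose y hy hDy using key
  refine ⟨∑ g ∈ s, y g, sum_mem fun g _ => hy g, ?_⟩
  rw [map_sum]
  simp_rw [hDy]
  exact (hs s subset_rfl).symm

end Exact

/-! ### From Koszul homology to graded Tor -/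

section GradedSection

/-- A surjection of graded vector spaces that preserves degrees has a linear section that
preserves degrees. -/
lemma exists_graded_section {k : Type*} [Field k] {F M : Type*} [AddCommGroup F] [Module k F]
    [AddCommGroup M] [Module k M] {𝓕 : ℕ → Submodule k F} {ℳ : ℕ → Submodule k M}
    (h𝓕 : ⨆ j, 𝓕 j = ⊤) (hℳ : DirectSum.IsInternal ℳ) (p : F →ₗ[k] M)
    (hp : Function.Surjective p) (hdeg : ∀ j, ∀ x ∈ 𝓕 j, p x ∈ ℳ j) :
    ∃ s : M →ₗ[k] F, p ∘ₗ s = LinearMap.id ∧ ∀ j, ∀ x ∈ ℳ j, s x ∈ 𝓕 j := by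
  classical
  have hs : ∀ j, Function.Surjective (p.restrict (hdeg j)) := by
    rintro j ⟨x, hx⟩
    obtain ⟨f, rfl⟩ := hp x
    have hft : f ∈ ⨆ j, 𝓕 j := by rw [h𝓕]; trivial
    obtain ⟨c, hc, rfl⟩ := (Submodule.mem_iSup_iff_exists_finsupp _ _).1 hft
    refine ⟨⟨c j, hc j⟩, Subtype.ext ?_⟩
    -- compare the components of degree `j` of the image of `∑ c i` and of `x ∈ ℳ j`
    have hind := (iSupIndep_iff_finsetSum_eq_zero_imp_eq_zero ℳ).1 hℳ.submodule_iSupIndep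
    have h0 := hind (insert j c.support)
      (fun i => if i = j then p (c j) - p (∑ i ∈ c.support, c i) else p (c i)) (by
        intro i _
        split_ifs with h
        · subst h; exact sub_mem (hdeg _ _ (hc _)) hx
        · exact hdeg _ _ (hc _)) (by
        rw [← Finset.add_sum_erase _ _ (Finset.mem_insert_self j _), if_pos rfl,
          Finset.sum_congr rfl (g := fun i => p (c i))
            (fun i hi => if_neg (Finset.ne_of_mem_erase hi))]
        have : ∑ i ∈ c.support, c i = ∑ i ∈ insert j c.support, c i :=
          Finset.sum_subset (Finset.subset_insert _ _) fun i _ hi => by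
            simpa using hi
        rw [this, map_sum, ← Finset.add_sum_erase _ (fun i => p (c i))
          (Finset.mem_insert_self j c.support)]
        abel) j (Finset.mem_insert_self _ _)
    rw [if_pos rfl, sub_eq_zero] at h0
    exact h0
  choose σ hσ using fun j => LinearMap.exists_rightInverse_of_surjective _
    (LinearMap.range_eq_top.2 (hs j))
  let e := LinearEquiv.ofBijective (DirectSum.coeLinearMap ℳ) hℳ
  let s : M →ₗ[k] F := DirectSum.toModule k ℕ F (fun j => (𝓕 j).subtype ∘ₗ σ j) ∘ₗ
    e.symm.toLinearMap
  have hval : ∀ j (x : ℳ j), s x = σ j x := by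
    intro j x
    have : e.symm (x : M) = DirectSum.lof k ℕ (fun j => ℳ j) j x := by
      rw [LinearEquiv.symm_apply_eq]
      exact (DirectSum.coeLinearMap_lof ℳ j x).symm
    simp [s, this]
  refine ⟨s, ?_, fun j x hx => ?_⟩
  · refine LinearMap.ext fun x => ?_
    have hx : x ∈ ⨆ j, ℳ j := by rw [hℳ.submodule_iSup_eq_top]; trivial
    refine Submodule.iSup_induction ℳ (motive := fun x => (p ∘ₗ s) x = LinearMap.id x) hx
      (fun j y hy => ?_) (by simp) (fun a b ha hb => by rw [map_add, ha, hb, map_add])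
    have := congrArg Subtype.val (LinearMap.congr_fun (hσ j) ⟨y, hy⟩)
    simp only [LinearMap.comp_apply, LinearMap.id_apply, LinearMap.coe_restrict_apply] at this ⊢
    rw [hval j ⟨y, hy⟩]
    exact this
  · rw [hval j ⟨x, hx⟩]
    exact (σ j _).2

/-- The kernel of a degree-preserving map of graded vector spaces is graded. -/
lemma isInternal_ker {k : Type*} [Field k] {F M : Type*} [AddCommGroup F] [Module k F]
    [AddCommGroup M] [Module k M] {𝓕 : ℕ → Submodule k F} {ℳ : ℕ → Submodule k M}
    (h𝓕 : DirectSum.IsInternal 𝓕) (hℳ : iSupIndep ℳ) (p : F →ₗ[k] M)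
    (hdeg : ∀ j, ∀ x ∈ 𝓕 j, p x ∈ ℳ j) (K : Submodule k F) (hK : K = LinearMap.ker p) :
    DirectSum.IsInternal fun j => (𝓕 j).comap K.subtype := by
  classical
  subst hK
  have hind := (iSupIndep_iff_finsetSum_eq_zero_imp_eq_zero ℳ).1 hℳ
  have hind' := (iSupIndep_iff_finsetSum_eq_zero_imp_eq_zero 𝓕).1 h𝓕.submodule_iSupIndep
  refine DirectSum.isInternal_submodule_of_iSupIndep_of_iSup_eq_top ?_ ?_
  · rw [iSupIndep_iff_finsetSum_eq_zero_imp_eq_zero]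
    intro s v hv hsum j hj
    refine Subtype.ext (hind' s (fun j => (v j : F)) (fun i hi => hv i hi) ?_ j hj)
    have := congrArg Subtype.val hsum
    rw [AddSubmonoidClass.coe_finsetSum] at this
    exact this
  · refine eq_top_iff.2 ?_
    rintro ⟨f, hf⟩ -
    have hft : f ∈ ⨆ j, 𝓕 j := by rw [h𝓕.submodule_iSup_eq_top]; trivial
    obtain ⟨c, hc, rfl⟩ := (Submodule.mem_iSup_iff_exists_finsupp _ _).1 hft
    have h0 := hind c.support (fun j => p (c j)) (fun j _ => hdeg j _ (hc j)) (by
      rw [← map_sum]; exact hf)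
    have h1 : ∀ j, c j ∈ LinearMap.ker p := by
      intro j
      by_cases hj : j ∈ c.support
      · exact h0 j hj
      · rw [Finsupp.notMem_support_iff.1 hj]; exact zero_mem _
    have h2 : (⟨c.sum fun _ x => x, hf⟩ : LinearMap.ker p) =
        ∑ j ∈ c.support, (⟨c j, h1 j⟩ : LinearMap.ker p) :=
      Subtype.ext (by rw [AddSubmonoidClass.coe_finsetSum]; rfl)
    refine (congrArg (· ∈ _) h2).mpr ?_
    exact sum_mem fun j _ => Submodule.mem_iSup_of_mem j (hc j)

end GradedSection

section Tor

variable {k : Type u} [Field k] {V : Type v} [AddCommGroup V] [Module k V]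
  [FiniteDimensional k V]

/-- Dimension shifting: if the Koszul homology of `M` vanishes in homological degree `i + 1`, then
an element of the Koszul complex of the kernel of `F → M` that bounds in `F` bounds in the
kernel. -/
lemma exists_koszul_boundary_ker {F M : Type*} [AddCommGroup F] [Module k F]
    [Module (SymmetricAlgebra k V) F] [IsScalarTower k (SymmetricAlgebra k V) F]
    [AddCommGroup M] [Module k M]
    [Module (SymmetricAlgebra k V) M] [IsScalarTower k (SymmetricAlgebra k V) M]
    {𝓕 : ℕ → Submodule k F} {ℳ : ℕ → Submodule k M}
    (h𝓕 : ⨆ j, 𝓕 j = ⊤) (hℳ : DirectSum.IsInternal ℳ)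
    (h𝓕s : ∀ b, ∀ s ∈ symPow k V 1, ∀ x ∈ 𝓕 b, s • x ∈ 𝓕 (b + 1))
    (p : F →ₗ[SymmetricAlgebra k V] M)
    (hp : Function.Surjective p) (hdeg : ∀ j, ∀ x ∈ 𝓕 j, p x ∈ ℳ j) {i j : ℕ}
    (hM : KoszulVanishes k V ℳ (i + 1) j) {z : KoszulSpace k V (LinearMap.ker p)}
    {y : KoszulSpace k V F} (hy : y ∈ koszulDegree k V 𝓕 (i + 1) j)
    (hzy : LinearMap.lTensor _ ((LinearMap.ker p).subtype.restrictScalars k) z =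
      koszulD k V F y) :
    ∃ y' ∈ koszulDegree k V
      (fun j => (𝓕 j).comap ((LinearMap.ker p).subtype.restrictScalars k)) (i + 1) j,
      koszulD k V _ y' = z := by
  obtain ⟨s, hs, hsdeg⟩ := exists_graded_section h𝓕 hℳ (p.restrictScalars k) hp hdeg
  have hs' : ∀ x, p (s x) = x := fun x => LinearMap.congr_fun hs x
  let f : LinearMap.ker p →ₗ[k] F := (LinearMap.ker p).subtype.restrictScalars k
  let q : F →ₗ[k] LinearMap.ker p :=
    { toFun := fun x => ⟨x - s (p x), by simp [hs']⟩
      map_add' := fun x y => Subtype.ext (by simp; abel)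
      map_smul' := fun c x => Subtype.ext (by
        have : p (c • x) = c • p x := (p.restrictScalars k).map_smul c x
        simp [this, smul_sub]) }
  have hqf : q ∘ₗ f = LinearMap.id := LinearMap.ext fun x => Subtype.ext (by
    have : p (x : F) = 0 := x.2
    simp [q, f, this])
  have hfq : f ∘ₗ q = LinearMap.id - s ∘ₗ p.restrictScalars k := LinearMap.ext fun x => by
    simp [q, f]
  have hpf : p.restrictScalars k ∘ₗ f = 0 := LinearMap.ext fun x => x.2
  have hy1 : koszulD k V M (LinearMap.lTensor _ (p.restrictScalars k) y) = 0 := by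
    rw [koszulD_lTensor, ← hzy]
    refine (lTensor_lTensor (p.restrictScalars k) f z).trans ?_
    rw [hpf, LinearMap.lTensor_zero, LinearMap.zero_apply]
  -- `y` maps to a cycle in the Koszul complex of `M`; lift a bounding element and subtract
  obtain ⟨t, ht, hDt⟩ := hM _ (lTensor_mem_koszulDegree (p.restrictScalars k) rfl
    (fun b hb x hx => ⟨b, hb, hdeg b x hx⟩) hy) hy1
  set t' : KoszulSpace k V F := LinearMap.lTensor _ s t with ht'
  have ht'mem : t' ∈ koszulDegree k V 𝓕 (i + 1 + 1) j :=
    lTensor_mem_koszulDegree (N := F) s rfl (fun b hb x hx => ⟨b, hb, hsdeg b x hx⟩) ht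
  have hpt' : LinearMap.lTensor _ (p.restrictScalars k) t' = t := by
    rw [ht', lTensor_lTensor, hs, LinearMap.lTensor_id, LinearMap.id_apply]
  set y₁ := y - koszulD k V F t' with hy₁
  have hy₁mem : y₁ ∈ koszulDegree k V 𝓕 (i + 1) j :=
    sub_mem hy (koszulD_mem_koszulDegree h𝓕s ht'mem)
  have hpy₁ : LinearMap.lTensor _ (p.restrictScalars k) y₁ = 0 := by
    rw [hy₁, map_sub, ← koszulD_lTensor, hpt', hDt, sub_self]
  have hfy : LinearMap.lTensor _ f (LinearMap.lTensor _ q y₁) = y₁ := by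
    rw [lTensor_lTensor, hfq, LinearMap.lTensor_sub, LinearMap.sub_apply, LinearMap.lTensor_id,
      LinearMap.id_apply, ← lTensor_lTensor, hpy₁, map_zero, sub_zero]
  refine ⟨LinearMap.lTensor _ q y₁, ?_, ?_⟩
  · refine lTensor_mem_koszulDegree (N := LinearMap.ker p) q rfl (fun b hb x hx => ⟨b, hb, ?_⟩)
      hy₁mem
    exact sub_mem hx (hsdeg b _ (hdeg b x hx))
  · have hinj : Function.LeftInverse (LinearMap.lTensor (ExteriorAlgebra k V) q)
        (LinearMap.lTensor (ExteriorAlgebra k V) f) := fun x => by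
      rw [lTensor_lTensor, hqf, LinearMap.lTensor_id, LinearMap.id_apply]
    refine hinj.injective ?_
    refine (koszulD_lTensor (LinearMap.ker p).subtype (LinearMap.lTensor _ q y₁)).symm.trans ?_
    refine (congrArg (koszulD k V F) hfy).trans ?_
    rw [hy₁, map_sub, koszulD_koszulD, sub_zero]
    exact hzy.symm

variable {M : Type (max u v)} [AddCommGroup M] [Module k M]
  [Module (SymmetricAlgebra k V) M] [IsScalarTower k (SymmetricAlgebra k V) M]

/-- If the image of `x` in `M` is a Koszul boundary, then `x` agrees modulo the kernel of the
surjection `p : F → M` with an element whose coordinates lie in `Sym(V)₊`. -/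
lemma exists_vanishesAtOrigin_of_boundary {G : Type (max u v)} (deg : G → ℕ)
    {ℳ : ℕ → Submodule k M} (hℳ : DirectSum.IsInternal ℳ)
    (p : (G →₀ SymmetricAlgebra k V) →ₗ[SymmetricAlgebra k V] M)
    (hp : Function.Surjective p) (hdeg : ∀ j, ∀ x ∈ freeDegree (symPow k V) deg j, p x ∈ ℳ j)
    {j : ℕ} {x : M} {y : KoszulSpace k V M} (hy : y ∈ koszulDegree k V ℳ 1 j)
    (hD : koszulD k V M y = 1 ⊗ₜ x) :
    ∃ x', VanishesAtOrigin x' ∧ p x' = x := by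
  obtain ⟨s, hs, hsdeg⟩ := exists_graded_section (iSup_freeDegree (𝒜 := symPow k V) deg) hℳ
    (p.restrictScalars k) hp hdeg
  have hy' : LinearMap.lTensor _ s y ∈ koszulDegree k V (freeDegree (symPow k V) deg) 1 j :=
    lTensor_mem_koszulDegree (N := G →₀ SymmetricAlgebra k V) s rfl
      (fun b hb x hx => ⟨b, hb, hsdeg b x hx⟩) hy
  have hz := koszulD_mem_koszulDegree (i := 0)
    (fun b s hs x hx => by
      rw [add_comm b 1]; exact freeDegree_smul_mem deg 1 b s hs x hx) hy'
  obtain ⟨x', hx', hDx'⟩ := exists_eq_one_tmul_of_mem_koszulDegree hz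
  refine ⟨x', vanishesAtOrigin_of_koszulD _ hDx', one_tmul_injective (k := k) (V := V) ?_⟩
  dsimp only
  rw [← hD]
  have h1 := koszulD_lTensor p (LinearMap.lTensor _ s y)
  rw [hDx', lTensor_lTensor, hs, LinearMap.lTensor_id, LinearMap.id_apply, hD] at h1
  rw [hD, h1]
  rfl

lemma one_mem_exteriorPower_zero : (1 : ExteriorAlgebra k V) ∈ ⋀[k]^0 V := by
  rw [ExteriorAlgebra.exteriorPower, pow_zero]
  exact Submodule.one_le.1 le_rfl

namespace GradedFreeResolution

variable {ℳ : ℕ → Submodule k M}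

/-- The grading of the kernel of the augmentation. -/
noncomputable abbrev kerDegree (F : GradedFreeResolution (symPow k V) ℳ) (j : ℕ) :
    Submodule k (LinearMap.ker F.aug) :=
  (freeDegree (symPow k V) (F.deg 0) j).comap ((LinearMap.ker F.aug).subtype.restrictScalars k)

/-- The kernel of the augmentation of a graded free resolution, resolved by the remaining
terms. -/
noncomputable def shift (F : GradedFreeResolution (symPow k V) ℳ) :
    GradedFreeResolution (symPow k V) (M := LinearMap.ker F.aug) F.kerDegree where
  gen n := F.gen (n + 1)
  deg n := F.deg (n + 1)
  d n := F.d (n + 1)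
  aug := (F.d 0).codRestrict _ fun x => (F.exact_zero _).2 ⟨x, rfl⟩
  d_degree n g := F.d_degree (n + 1) g
  aug_degree g := F.d_degree 0 g
  aug_surjective := by
    rintro ⟨x, hx⟩
    obtain ⟨y, rfl⟩ := (F.exact_zero x).1 hx
    exact ⟨y, rfl⟩
  exact_zero x := by
    rw [← F.exact_succ 0 x]
    exact Subtype.ext_iff
  exact_succ n := F.exact_succ (n + 1)

/-- Every cycle of `F i ⊗ k` of degree `j` is a boundary, stated for representatives in `F i`. -/
def TorVanishes (F : GradedFreeResolution (symPow k V) ℳ) (j : ℕ) : ℕ → Prop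
  | 0 => ∀ x ∈ freeDegree (symPow k V) (F.deg 0) j, ∃ y, VanishesAtOrigin (x - F.d 0 y)
  | i + 1 => ∀ x ∈ freeDegree (symPow k V) (F.deg (i + 1)) j, VanishesAtOrigin (F.d i x) →
      ∃ y, VanishesAtOrigin (x - F.d (i + 1) y)

lemma aug_mem (F : GradedFreeResolution (symPow k V) ℳ)
    (hℳ : IsGradedModule (symPow k V) ℳ) (j : ℕ)
    (x) (hx : x ∈ freeDegree (symPow k V) (F.deg 0) j) : F.aug x ∈ ℳ j := by
  have h := linearCombination_mem_degree (F.deg 0) hℳ.smul_mem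
    (fun g => F.aug (Finsupp.single g 1)) F.aug_degree j x hx
  convert h using 1
  conv_lhs => rw [← x.sum_single]
  rw [Finsupp.linearCombination_apply, Finsupp.sum, Finsupp.sum, map_sum]
  refine Finset.sum_congr rfl fun g _ => ?_
  rw [← map_smul, Finsupp.smul_single, smul_eq_mul, mul_one]

lemma isGradedModule_ker (F : GradedFreeResolution (symPow k V) ℳ)
    (hℳ : IsGradedModule (symPow k V) ℳ) :
    IsGradedModule (symPow k V) (M := LinearMap.ker F.aug) F.kerDegree where
  smul_mem a b s hs x hx := freeDegree_smul_mem (F.deg 0) a b s hs _ hx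
  isInternal := by
    have hF : DirectSum.IsInternal (freeDegree (symPow k V) (F.deg 0)) :=
      DirectSum.isInternal_submodule_of_iSupIndep_of_iSup_eq_top (iSupIndep_freeDegree _)
        (iSup_freeDegree _)
    exact isInternal_ker hF hℳ.isInternal.submodule_iSupIndep (F.aug.restrictScalars k)
      (F.aug_mem hℳ) ((LinearMap.ker F.aug).restrictScalars k) rfl

lemma one_tmul_aug_mem (F : GradedFreeResolution (symPow k V) ℳ)
    (hℳ : IsGradedModule (symPow k V) ℳ) {j : ℕ} {x : F.gen 0 →₀ SymmetricAlgebra k V}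
    (hx : x ∈ freeDegree (symPow k V) (F.deg 0) j) :
    (1 : ExteriorAlgebra k V) ⊗ₜ[k] F.aug x ∈ koszulDegree k V ℳ 0 j :=
  tmul_mem_koszulDegree (zero_add j) one_mem_exteriorPower_zero (F.aug_mem hℳ j x hx)

lemma exists_vanishesAtOrigin_sub (F : GradedFreeResolution (symPow k V) ℳ)
    (hℳ : IsGradedModule (symPow k V) ℳ) {j : ℕ} {x : F.gen 0 →₀ SymmetricAlgebra k V}
    (h : ∃ y ∈ koszulDegree k V ℳ 1 j, koszulD k V M y = 1 ⊗ₜ F.aug x) :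
    ∃ w, VanishesAtOrigin (x - F.d 0 w) := by
  obtain ⟨y, hy, hDy⟩ := h
  obtain ⟨x', hx', hpx'⟩ := exists_vanishesAtOrigin_of_boundary (F.deg 0) hℳ.isInternal F.aug
    F.aug_surjective (F.aug_mem hℳ) hy hDy
  obtain ⟨w, hw⟩ := (F.exact_zero (x - x')).1 (by rw [map_sub, hpx', sub_self])
  exact ⟨w, by rwa [hw, sub_sub_cancel]⟩

/-- A Koszul cycle of the kernel of the augmentation bounds if Koszul homology of `M` vanishes in
the next homological degree. In homological degree `0` the cycle must have coefficients in
`Sym(V)₊`. -/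
lemma exists_koszul_boundary [CharZero k] (F : GradedFreeResolution (symPow k V) ℳ)
    (hℳ : IsGradedModule (symPow k V) ℳ) {i j : ℕ} (h : KoszulVanishes k V ℳ (i + 1) j)
    {z : KoszulSpace k V (LinearMap.ker F.aug)}
    (hz : z ∈ koszulDegree k V (M := LinearMap.ker F.aug) F.kerDegree i j)
    (hD : koszulD k V (LinearMap.ker F.aug) z = 0)
    (h0 : i = 0 → ∃ x, VanishesAtOrigin x ∧
      LinearMap.lTensor _ ((LinearMap.ker F.aug).subtype.restrictScalars k) z = 1 ⊗ₜ x) :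
    ∃ y' ∈ koszulDegree k V (M := LinearMap.ker F.aug) F.kerDegree (i + 1) j,
      koszulD k V (LinearMap.ker F.aug) y' = z := by
  obtain ⟨y, hy, hDy⟩ := koszul_free_exact (F.deg 0)
    (z := LinearMap.lTensor _ ((LinearMap.ker F.aug).subtype.restrictScalars k) z)
    (lTensor_mem_koszulDegree _ rfl (fun b hb x hx => ⟨b, hb, hx⟩) hz)
    ((koszulD_lTensor _ _).trans (by rw [hD, map_zero])) h0
  exact exists_koszul_boundary_ker (iSup_freeDegree (𝒜 := symPow k V) (F.deg 0)) hℳ.isInternal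
    (fun b s hs x hx => by rw [add_comm b 1]; exact freeDegree_smul_mem (F.deg 0) 1 b s hs x hx)
    F.aug F.aug_surjective (F.aug_mem hℳ) h hy hDy.symm

lemma koszulVanishes_ker [CharZero k] (F : GradedFreeResolution (symPow k V) ℳ)
    (hℳ : IsGradedModule (symPow k V) ℳ) {i j : ℕ} (h : KoszulVanishes k V ℳ (i + 1 + 1) j) :
    KoszulVanishes k V (M := LinearMap.ker F.aug) F.kerDegree (i + 1) j :=
  fun _ hz hD => F.exists_koszul_boundary hℳ h hz hD fun h => absurd h (Nat.succ_ne_zero i)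

/-- Vanishing of Koszul homology implies vanishing of Tor, by dimension shifting. -/
lemma torVanishes_of_koszulVanishes [CharZero k] (i : ℕ) {j : ℕ} :
    ∀ {M : Type (max u v)} [AddCommGroup M] [Module k M] [Module (SymmetricAlgebra k V) M]
      [IsScalarTower k (SymmetricAlgebra k V) M] {ℳ : ℕ → Submodule k M}
      (F : GradedFreeResolution (symPow k V) ℳ) (_ : IsGradedModule (symPow k V) ℳ),
      KoszulVanishes k V ℳ i j → F.TorVanishes j i := by
  induction i with
  | zero =>
    intro M _ _ _ _ ℳ F hℳ h x hx
    have hz := F.one_tmul_aug_mem hℳ hx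
    exact F.exists_vanishesAtOrigin_sub hℳ (h _ hz (koszulD_zero_degree hz))
  | succ i ih =>
    intro M _ _ _ _ ℳ F hℳ h
    have hN := F.isGradedModule_ker hℳ
    cases i with
    | zero =>
      intro x hx hdx
      have hz := F.shift.one_tmul_aug_mem hN hx
      exact F.shift.exists_vanishesAtOrigin_sub hN
        (F.exists_koszul_boundary hℳ h hz (koszulD_zero_degree hz) fun _ => ⟨F.d 0 x, hdx, rfl⟩)
    | succ i => exact ih F.shift hN (F.koszulVanishes_ker hℳ h)

/-- The map `F n → F n ⊗ k`, `f ↦ f ⊗ 1`. -/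
noncomputable def tensorOne (F : GradedFreeResolution (symPow k V) ℳ) (n : ℕ) :
    F.obj n →ₗ[SymmetricAlgebra k V] F.term (ResidueModule k V) n :=
  (TensorProduct.mk (SymmetricAlgebra k V) (F.obj n) (ResidueModule k V)).flip (1 : k)

lemma tensorOne_smul (F : GradedFreeResolution (symPow k V) ℳ) (n : ℕ) (c : k) (f : F.obj n) :
    F.tensorOne n (c • f) = c • F.tensorOne n f := rfl

/-- In `F n ⊗ k` the tensor `f ⊗ 1` vanishes exactly when the coordinates of `f` lie in
`Sym(V)₊`. -/
lemma tensorOne_eq_zero_iff (F : GradedFreeResolution (symPow k V) ℳ) (n : ℕ)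
    (f : F.gen n →₀ SymmetricAlgebra k V) :
    F.tensorOne n f = 0 ↔ VanishesAtOrigin f := by
  constructor
  · intro h g
    let φ : F.obj n →ₗ[SymmetricAlgebra k V] ResidueModule k V →ₗ[SymmetricAlgebra k V]
        ResidueModule k V :=
      (LinearMap.lsmul (SymmetricAlgebra k V) (ResidueModule k V)) ∘ₗ
        (show F.obj n →ₗ[SymmetricAlgebra k V] SymmetricAlgebra k V from Finsupp.lapply g)
    have h1 : φ f (1 : k) = 0 :=
      (TensorProduct.lift.tmul (f' := φ) _ _).symm.trans
        ((congrArg (TensorProduct.lift φ) h).trans (map_zero _))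
    have h2 : SymmetricAlgebra.algebraMapInv (f g) * (1 : k) = 0 := h1
    rwa [mul_one] at h2
  · intro h
    have hs : ∀ g, F.tensorOne n (Finsupp.single g (f g)) = 0 := by
      intro g
      have h1 : Finsupp.single g (f g) = f g • Finsupp.single g (1 : SymmetricAlgebra k V) := by
        rw [Finsupp.smul_single, smul_eq_mul, mul_one]
      have h2 : f g • (show ResidueModule k V from (1 : k)) = 0 := by
        have h2 : SymmetricAlgebra.algebraMapInv (f g) * (1 : k) = 0 := by rw [h g, zero_mul]
        exact h2
      rw [h1]
      refine (TensorProduct.smul_tmul (R := SymmetricAlgebra k V) (f g)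
        (show F.obj n from Finsupp.single g 1) (show ResidueModule k V from (1 : k))).trans ?_
      rw [h2]
      exact TensorProduct.tmul_zero _ _
    have h3 : F.tensorOne n (∑ g ∈ f.support, (show F.obj n from Finsupp.single g (f g))) = 0 := by
      rw [map_sum]
      exact Finset.sum_eq_zero fun g _ => hs g
    have h4 : (∑ g ∈ f.support, (show F.obj n from Finsupp.single g (f g))) = f := f.sum_single
    rwa [h4] at h3

lemma exists_of_mem_termDegree (F : GradedFreeResolution (symPow k V) ℳ) {n j : ℕ}
    {t : F.term (ResidueModule k V) n}
    (ht : t ∈ F.termDegree (residueDegree k V) n j) :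
    ∃ f ∈ F.objDegree n j, t = F.tensorOne n f := by
  induction ht using Submodule.span_induction with
  | zero => exact ⟨0, zero_mem _, (map_zero (F.tensorOne n)).symm⟩
  | add x y _ _ hx hy =>
    obtain ⟨f, hf, rfl⟩ := hx
    obtain ⟨g, hg, rfl⟩ := hy
    exact ⟨f + g, add_mem hf hg, (map_add (F.tensorOne n) f g).symm⟩
  | smul c x _ hx =>
    obtain ⟨f, hf, rfl⟩ := hx
    exact ⟨c • f, Submodule.smul_mem _ _ hf, (F.tensorOne_smul n c f).symm⟩
  | mem t ht =>
    obtain ⟨a, b, rfl, f, hf, y, hy, rfl⟩ := ht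
    unfold residueDegree at hy
    split_ifs at hy with hb
    · subst hb
      let c : k := y
      refine ⟨c • f, Submodule.smul_mem _ _ hf, ?_⟩
      have h1 : y = algebraMap k (SymmetricAlgebra k V) c •
          (show ResidueModule k V from (1 : k)) := by
        have : c = SymmetricAlgebra.algebraMapInv (algebraMap k (SymmetricAlgebra k V) c) * 1 := by
          rw [AlgHom.commutes, mul_one]; rfl
        exact this
      have h2 : c • f = algebraMap k (SymmetricAlgebra k V) c • f := (algebraMap_smul _ c f).symm
      rw [h2, map_smul, h1]
      exact TensorProduct.tmul_smul _ _ _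
    · rw [Submodule.mem_bot] at hy
      refine ⟨0, zero_mem _, ?_⟩
      rw [hy, map_zero]
      exact TensorProduct.tmul_zero _ _

/-- Graded Tor with the residue field vanishes in the degrees in which Koszul homology does. -/
lemma homologyDegree_eq_bot [CharZero k] (F : GradedFreeResolution (symPow k V) ℳ)
    (hℳ : IsGradedModule (symPow k V) ℳ) {i j : ℕ} (h : KoszulVanishes k V ℳ i j) :
    F.homologyDegree (residueDegree k V) i j = ⊥ := by
  have hT := torVanishes_of_koszulVanishes i F hℳ h
  have hdiff : ∀ n (f : F.obj (n + 1)), F.diff (ResidueModule k V) n (F.tensorOne (n + 1) f) =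
      F.tensorOne n (F.dObj n f) := fun n f => LinearMap.rTensor_tmul _ _ _ _
  rw [eq_bot_iff]
  rintro _ ⟨⟨t, htc⟩, ht, rfl⟩
  obtain ⟨f, hf, rfl⟩ := F.exists_of_mem_termDegree ht
  rw [Submodule.mem_bot]
  refine (Submodule.Quotient.mk_eq_zero _).2 ?_
  have hy : ∃ y : F.obj (i + 1), F.tensorOne i (f - F.dObj i y) = 0 := by
    cases i with
    | zero =>
      obtain ⟨y, hy⟩ := hT f hf
      exact ⟨y, (F.tensorOne_eq_zero_iff _ _).2 hy⟩
    | succ i =>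
      obtain ⟨y, hy⟩ := hT f hf ((F.tensorOne_eq_zero_iff i _).1 ((hdiff i f).symm.trans htc))
      exact ⟨y, (F.tensorOne_eq_zero_iff _ _).2 hy⟩
  obtain ⟨y, hy⟩ := hy
  rw [map_sub, sub_eq_zero] at hy
  exact ⟨F.tensorOne (i + 1) y, (hdiff i y).trans hy.symm⟩

end GradedFreeResolution

end Tor

/-! ### Words of monomials and a noetherianity theorem -/

section Words

/-- A letter is a monomial in `n` variables together with a mark in `{0, …, i}`; the mark `0` means
that the letter is unmarked. Letters are ordered lexicographically. -/
abbrev Letter (i n : ℕ) : Type := Fin (i + 1) ×ₗ Lex (Fin n → ℕ)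

namespace Letter

variable {i n : ℕ}

/-- The letter with given mark and exponent vector. -/
def mk (m : Fin (i + 1)) (α : Fin n → ℕ) : Letter i n := toLex (m, toLex α)

/-- The mark of a letter. -/
def mark (a : Letter i n) : Fin (i + 1) := (ofLex a).1

/-- The exponent vector of a letter. -/
def expo (a : Letter i n) : Fin n → ℕ := ofLex (ofLex a).2

/-- The degree of the monomial of a letter. -/
def degree (a : Letter i n) : ℕ := ∑ c, a.expo c

/-- Multiplication of the monomial of a letter by the monomial with exponent vector `γ`. -/
def shift (γ : Fin n → ℕ) (a : Letter i n) : Letter i n := mk a.mark (γ + a.expo)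

@[simp] lemma mark_mk (m : Fin (i + 1)) (α : Fin n → ℕ) : (mk m α).mark = m := rfl

@[simp] lemma expo_mk (m : Fin (i + 1)) (α : Fin n → ℕ) : (mk m α).expo = α := rfl

@[simp] lemma mk_mark_expo (a : Letter i n) : mk a.mark a.expo = a := rfl

@[simp] lemma mark_shift (γ : Fin n → ℕ) (a : Letter i n) : (a.shift γ).mark = a.mark := rfl

@[simp] lemma expo_shift (γ : Fin n → ℕ) (a : Letter i n) : (a.shift γ).expo = γ + a.expo := rfl

lemma degree_shift (γ : Fin n → ℕ) (a : Letter i n) :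
    (a.shift γ).degree = ∑ c, γ c + a.degree := by
  simp [degree, Finset.sum_add_distrib]

lemma shift_lt_shift (γ : Fin n → ℕ) {a b : Letter i n} (h : a < b) : a.shift γ < b.shift γ := by
  rw [Prod.Lex.lt_iff] at h ⊢
  refine h.imp id fun h => ⟨h.1, ?_⟩
  exact add_lt_add_right (α := Lex (Fin n → ℕ)) h.2 (toLex γ)

/-- Divisibility of letters: equal marks, and divisibility of monomials. -/
def Dvd (a b : Letter i n) : Prop := a.mark = b.mark ∧ a.expo ≤ b.expo

instance : IsPreorder (Letter i n) Dvd where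
  refl _ := ⟨rfl, le_rfl⟩
  trans _ _ _ h h' := ⟨h.1.trans h'.1, h.2.trans h'.2⟩

/-- Dickson's lemma for letters. -/
lemma wellQuasiOrdered_dvd : WellQuasiOrdered (Dvd (i := i) (n := n)) := by
  intro f
  have h1 : WellQuasiOrdered (α := Fin (i + 1)) (· = ·) := Finite.wellQuasiOrdered _
  have h2 : WellQuasiOrdered (α := Fin n → ℕ) (· ≤ ·) := wellQuasiOrdered_le
  obtain ⟨a, b, hab, h⟩ := (h1.prod h2) fun c => ((f c).mark, (f c).expo)
  exact ⟨a, b, hab, h⟩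

end Letter

variable {i n : ℕ}

/-- The words of length `N` whose letters have degree `d` and in which every mark other than `0`
occurs exactly once. -/
def wordSet (i n d N : ℕ) : Set (List (Letter i n)) :=
  {l | l.length = N ∧ (∀ a ∈ l, a.degree = d) ∧ ∀ s : Fin i, (l.map Letter.mark).count s.succ = 1}

lemma finite_setOf_sum_eq (n d : ℕ) : {α : Fin n → ℕ | ∑ c, α c = d}.Finite :=
  (Set.finite_Iic fun _ => d).subset fun α hα c => by
    rw [← show ∑ c, α c = d from hα]
    exact Finset.single_le_sum (fun _ _ => Nat.zero_le _) (Finset.mem_univ c)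

lemma wordSet_finite (i n d N : ℕ) : (wordSet i n d N).Finite := by
  have hfin : {a : Letter i n | a.degree = d}.Finite := by
    refine ((Set.finite_univ.prod (finite_setOf_sum_eq n d)).image
      fun p => Letter.mk p.1 p.2).subset fun a ha => ?_
    exact ⟨(a.mark, a.expo), ⟨trivial, ha⟩, rfl⟩
  have : Finite {a : Letter i n // a.degree = d} := hfin
  refine ((List.finite_length_eq {a : Letter i n // a.degree = d} N).image
    (List.map Subtype.val)).subset fun l hl => ?_
  exact ⟨l.attachWith _ hl.2.1, by simpa using hl.1,
    List.attachWith_map_subtype_val ..⟩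

/-- Letterwise multiplication of a word by a list of monomials. It is meaningful only for lists of
equal lengths; otherwise the longer one is truncated. -/
def mulWord (w : List (Fin n → ℕ)) (l : List (Letter i n)) : List (Letter i n) :=
  List.zipWith Letter.shift w l

/-- Insertion of an unmarked letter at a given position of a word. -/
def insertUnmarked (p : ℕ) (β : Fin n → ℕ) (l : List (Letter i n)) : List (Letter i n) :=
  l.insertIdx p (Letter.mk 0 β)

lemma mulWord_lt_mulWord (w : List (Fin n → ℕ)) {l l' : List (Letter i n)}
    (hl : l.length = w.length) (hl' : l'.length = w.length) (h : l < l') :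
    mulWord w l < mulWord w l' := by
  induction w generalizing l l' with
  | nil =>
    rw [List.length_nil, List.length_eq_zero_iff] at hl hl'
    subst hl hl'
    exact absurd h (lt_irrefl _)
  | cons γ w ih =>
    obtain ⟨a, l, rfl⟩ := List.exists_cons_of_length_eq_add_one hl
    obtain ⟨a', l', rfl⟩ := List.exists_cons_of_length_eq_add_one hl'
    simp only [List.length_cons, Nat.add_right_cancel_iff] at hl hl'
    simp only [mulWord, List.zipWith_cons_cons]
    rw [List.cons_lt_cons_iff] at h ⊢
    exact h.imp (Letter.shift_lt_shift γ) fun h => ⟨by rw [h.1], ih hl hl' h.2⟩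

lemma insertUnmarked_lt (p : ℕ) (β : Fin n → ℕ) {l l' : List (Letter i n)}
    (hl : p ≤ l.length) (hl' : p ≤ l'.length) (h : l < l') :
    insertUnmarked p β l < insertUnmarked p β l' := by
  unfold insertUnmarked
  induction p generalizing l l' with
  | zero =>
    rw [List.insertIdx_zero, List.insertIdx_zero, List.cons_lt_cons_iff]
    exact Or.inr ⟨rfl, h⟩
  | succ p ih =>
    match l, l', hl, hl' with
    | a :: l, a' :: l', hl, hl' =>
      rw [List.insertIdx_succ_cons, List.insertIdx_succ_cons]
      rw [List.cons_lt_cons_iff] at h ⊢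
      exact h.imp id fun h => ⟨h.1, ih (Nat.le_of_succ_le_succ hl) (Nat.le_of_succ_le_succ hl') h.2⟩

/-- Letterwise multiplication after an insertion is an insertion after letterwise multiplication,
by the list `w` without its entry `γ` at the position of the insertion. -/
lemma exists_mulWord_insertUnmarked {N p : ℕ} (w : List (Fin n → ℕ)) (hw : w.length = N + 1)
    (hp : p ≤ N) :
    ∃ γ ∈ w, ∃ w' : List (Fin n → ℕ), w'.length = N ∧ (∀ δ ∈ w', δ ∈ w) ∧
      ∀ (β : Fin n → ℕ) (l : List (Letter i n)), l.length = N →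
        mulWord w (insertUnmarked p β l) = insertUnmarked p (γ + β) (mulWord w' l) := by
  unfold insertUnmarked mulWord
  induction p generalizing N w with
  | zero =>
    obtain ⟨γ, w, rfl⟩ := List.exists_cons_of_length_eq_add_one hw
    exact ⟨γ, by simp, w, by simpa using hw, fun δ hδ => by simp [hδ], fun _ _ _ => rfl⟩
  | succ p ih =>
    obtain ⟨γ, w, rfl⟩ := List.exists_cons_of_length_eq_add_one hw
    obtain ⟨N, rfl⟩ := Nat.exists_eq_add_of_le' (Nat.one_le_of_lt hp)
    obtain ⟨γ', hγ', w', hw', hsub, h⟩ := ih w (by simpa using hw) (Nat.le_of_succ_le_succ hp)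
    refine ⟨γ', by simp [hγ'], γ :: w', by simp [hw'], ?_, ?_⟩
    · intro δ hδ
      rcases List.mem_cons.1 hδ with rfl | hδ
      · simp
      · simp [hsub δ hδ]
    · intro β l hl
      obtain ⟨a, l, rfl⟩ := List.exists_cons_of_length_eq_add_one hl
      simp [h β l (by simpa using hl)]

lemma mulWord_mulWord (w w' : List (Fin n → ℕ)) (l : List (Letter i n)) :
    mulWord w' (mulWord w l) = mulWord (List.zipWith (· + ·) w' w) l := by
  unfold mulWord
  induction l generalizing w w' with
  | nil => simp
  | cons a l ih =>
    cases w with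
    | nil => simp
    | cons γ w =>
      cases w' with
      | nil => simp
      | cons γ' w' => simp [ih, Letter.shift, add_assoc]

lemma mulWord_replicate_zero (l : List (Letter i n)) :
    mulWord (List.replicate l.length 0) l = l := by
  unfold mulWord
  induction l with
  | nil => rfl
  | cons a l ih => simp [List.replicate_succ, ih, Letter.shift]

/-- If `m` is a proper subword of `l` with the same marks, then some unmarked letter of `l` can be
deleted so that `m` remains a subword. -/
lemma exists_insertUnmarked_of_sublist {m l : List (Letter i n)} (h : m.Sublist l)
    (hlen : m.length < l.length)
    (hmark : ∀ s : Fin i, (m.map Letter.mark).count s.succ = (l.map Letter.mark).count s.succ) :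
    ∃ p β l', p ≤ l'.length ∧ l = insertUnmarked p β l' ∧ m.Sublist l' := by
  induction h with
  | slnil => simp at hlen
  | @cons m l a h ih =>
    refine ⟨0, a.expo, l, Nat.zero_le _, ?_, h⟩
    have ha : a.mark = 0 := by
      by_contra ha
      obtain ⟨s, hs⟩ := Fin.exists_succ_eq.2 ha
      have h1 := hmark s
      rw [List.map_cons, List.count_cons, hs] at h1
      have h2 := (h.map Letter.mark).count_le s.succ
      rw [hs] at h2
      simp at h1
      omega
    rw [insertUnmarked, List.insertIdx_zero, ← ha, Letter.mk_mark_expo]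
  | @cons_cons m l a h ih =>
    obtain ⟨p, β, l', hp, rfl, hsub⟩ := ih (by simpa using hlen) fun s => by
      have := hmark s
      rw [List.map_cons, List.map_cons, List.count_cons, List.count_cons] at this
      omega
    exact ⟨p + 1, β, a :: l', by simpa using hp, rfl, hsub.cons_cons a⟩

lemma insertUnmarked_perm {p : ℕ} (β : Fin n → ℕ) {l : List (Letter i n)} (hp : p ≤ l.length) :
    (insertUnmarked p β l).Perm (Letter.mk 0 β :: l) :=
  List.perm_insertIdx _ _ hp

lemma insertUnmarked_mem_wordSet_iff {d N p : ℕ} {β : Fin n → ℕ} {l : List (Letter i n)}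
    (hp : p ≤ l.length) : insertUnmarked p β l ∈ wordSet i n d (N + 1) ↔
      l ∈ wordSet i n d N ∧ ∑ c, β c = d := by
  have hperm := insertUnmarked_perm β hp
  have h1 : ∀ s : Fin i, ((insertUnmarked p β l).map Letter.mark).count s.succ =
      (l.map Letter.mark).count s.succ := fun s => by
    rw [(hperm.map _).count_eq, List.map_cons, List.count_cons, Letter.mark_mk]
    simp [(Fin.succ_ne_zero s).symm]
  have h2 : (∀ a ∈ insertUnmarked p β l, a.degree = d) ↔
      ∑ c, β c = d ∧ ∀ a ∈ l, a.degree = d := by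
    simp_rw [hperm.mem_iff, List.forall_mem_cons]
    rfl
  simp only [wordSet, Set.mem_ofPred_eq, h1, h2, hperm.length_eq, List.length_cons,
    Nat.add_right_cancel_iff]
  tauto

lemma mulWord_mem_wordSet {d e N : ℕ} {w : List (Fin n → ℕ)} (hw : w.length = N)
    (hwe : ∀ γ ∈ w, ∑ c, γ c = e) {l : List (Letter i n)} (hl : l ∈ wordSet i n d N) :
    mulWord w l ∈ wordSet i n (e + d) N := by
  obtain ⟨h1, h2, h3⟩ := hl
  refine ⟨by simp [mulWord, hw, h1], ?_, ?_⟩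
  · intro a ha
    rw [mulWord, List.mem_iff_getElem] at ha
    obtain ⟨j, hj, rfl⟩ := ha
    rw [List.getElem_zipWith, Letter.degree_shift, hwe _ (List.getElem_mem _),
      h2 _ (List.getElem_mem _)]
  · have : (mulWord w l).map Letter.mark = l.map Letter.mark := by
      refine List.ext_getElem (by simp [mulWord, hw, h1]) fun j _ _ => ?_
      simp [mulWord]
    rwa [this]

section Leading

variable {k : Type*} [Field k] {X : Type*} [LinearOrder X]

/-- `x` is the largest element of the support of some element of `L`. -/
def IsLeading (L : Submodule k (X →₀ k)) (x : X) : Prop :=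
  ∃ t ∈ L, t x ≠ 0 ∧ ∀ y ∈ t.support, y ≤ x

/-- A subspace that has all the leading terms of a larger one, with supports in a finite set, is
equal to it. -/
lemma le_of_isLeading {L L' : Submodule k (X →₀ k)} {W : Set X} (hW : W.Finite)
    (hL : ∀ t ∈ L, ∀ x ∈ t.support, x ∈ W) (hle : L' ≤ L)
    (hlead : ∀ x, IsLeading L x → IsLeading L' x) : L ≤ L' := by
  classical
  suffices h : ∀ m, ∀ t ∈ L,
      (hW.toFinset.filter fun y => ∃ x ∈ t.support, y ≤ x).card ≤ m → t ∈ L' from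
    fun t ht => h _ t ht le_rfl
  intro m
  induction m with
  | zero =>
    intro t ht hm
    have ht0 : t = 0 := by
      by_contra h0
      obtain ⟨x, hx⟩ := Finsupp.support_nonempty_iff.2 h0
      have : x ∈ hW.toFinset.filter fun y => ∃ x ∈ t.support, y ≤ x :=
        Finset.mem_filter.2 ⟨hW.mem_toFinset.2 (hL t ht x hx), x, hx, le_rfl⟩
      exact absurd (Finset.card_pos.2 ⟨x, this⟩) (by omega)
    rw [ht0]; exact zero_mem _
  | succ m ih =>
    intro t ht hm
    by_cases h0 : t = 0
    · rw [h0]; exact zero_mem _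
    obtain ⟨x, hx, hmax⟩ := t.support.exists_max_image id (Finsupp.support_nonempty_iff.2 h0)
    have hxt := Finsupp.mem_support_iff.1 hx
    obtain ⟨t', ht', hx', hmax'⟩ := hlead x ⟨t, ht, hxt, hmax⟩
    set r := t - (t x / t' x) • t' with hr
    have hrL : r ∈ L := sub_mem ht (Submodule.smul_mem _ _ (hle ht'))
    have hlt : ∀ y ∈ r.support, y < x := by
      intro y hy
      refine lt_of_le_of_ne ?_ ?_
      · by_contra hyx
        have h1 : t y = 0 := by
          by_contra h; exact hyx (hmax y (Finsupp.mem_support_iff.2 h))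
        have h2 : t' y = 0 := by
          by_contra h; exact hyx (hmax' y (Finsupp.mem_support_iff.2 h))
        exact Finsupp.mem_support_iff.1 hy (by simp [hr, h1, h2])
      · rintro rfl
        exact Finsupp.mem_support_iff.1 hy (by simp [hr, hx'])
    have hrL' : r ∈ L' := by
      refine ih r hrL (Nat.le_of_lt_succ (lt_of_lt_of_le (Finset.card_lt_card ?_) hm))
      refine Finset.ssubset_iff_subset_ne.2 ⟨fun y hy => ?_, fun heq => ?_⟩
      · obtain ⟨hyW, z, hz, hyz⟩ := Finset.mem_filter.1 hy
        exact Finset.mem_filter.2 ⟨hyW, x, hx, hyz.trans (hlt z hz).le⟩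
      · have : x ∈ hW.toFinset.filter fun y => ∃ x ∈ t.support, y ≤ x :=
          Finset.mem_filter.2 ⟨hW.mem_toFinset.2 (hL t ht x hx), x, hx, le_rfl⟩
        rw [← heq] at this
        obtain ⟨-, z, hz, hxz⟩ := Finset.mem_filter.1 this
        exact absurd (hlt z hz) (not_lt.2 hxz)
    have : t = r + (t x / t' x) • t' := by rw [hr]; abel
    rw [this]
    exact add_mem hrL' (Submodule.smul_mem _ _ ht')

/-- Maps that are strictly monotone on supports carry leading terms to leading terms. -/
lemma IsLeading.mapDomain {L L' : Submodule k (X →₀ k)} {W : Set X}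
    (hL : ∀ t ∈ L, ∀ x ∈ t.support, x ∈ W) {τ : X → X}
    (hτ : ∀ x ∈ W, ∀ y ∈ W, x < y → τ x < τ y) (hLL' : ∀ t ∈ L, Finsupp.mapDomain τ t ∈ L')
    {x : X} (hx : IsLeading L x) : IsLeading L' (τ x) := by
  classical
  obtain ⟨t, ht, hxt, hmax⟩ := hx
  have hxs := Finsupp.mem_support_iff.2 hxt
  have hinj : Set.InjOn τ W := fun a ha b hb hab => by
    rcases lt_trichotomy a b with h | h | h
    · exact absurd hab (hτ a ha b hb h).ne
    · exact h
    · exact absurd hab (hτ b hb a ha h).ne'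
  refine ⟨_, hLL' t ht, ?_, fun y hy => ?_⟩
  · rwa [Finsupp.mapDomain_apply' W t (fun y hy => hL t ht y hy) hinj (hL t ht x hxs)]
  · obtain ⟨z, hz, rfl⟩ := Finset.mem_image.1 (Finsupp.mapDomain_support hy)
    rcases (hmax z hz).eq_or_lt with h | h
    · rw [h]
    · exact (hτ z (hL t ht z hz) x (hL t ht x hxs) h).le

end Leading

section Noetherian

variable {k : Type*} [Field k]

/-- The span of all combinations of words obtained by inserting an unmarked letter of degree `d`
into the elements of `L`. -/
noncomputable def insertionSpan (d N : ℕ) (L : Submodule k (List (Letter i n) →₀ k)) :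
    Submodule k (List (Letter i n) →₀ k) :=
  Submodule.span k {t | ∃ p ≤ N, ∃ β : Fin n → ℕ, ∑ c, β c = d ∧ ∃ u ∈ L,
    t = Finsupp.mapDomain (insertUnmarked p β) u}

/-- A family of spaces of words that is stable under letterwise multiplication by monomials and
under the insertion of unmarked letters. -/
structure IsStableFamily (L : ℕ → ℕ → Submodule k (List (Letter i n) →₀ k)) : Prop where
  support : ∀ d N, ∀ t ∈ L d N, ∀ l ∈ t.support, l ∈ wordSet i n d N
  mulWord_mem : ∀ d N e, ∀ w : List (Fin n → ℕ), w.length = N → (∀ γ ∈ w, ∑ c, γ c = e) →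
    ∀ t ∈ L d N, Finsupp.mapDomain (mulWord w) t ∈ L (e + d) N
  insert_mem : ∀ d N, ∀ p ≤ N, ∀ β : Fin n → ℕ, ∑ c, β c = d →
    ∀ t ∈ L d N, Finsupp.mapDomain (insertUnmarked p β) t ∈ L d (N + 1)

namespace IsStableFamily

variable {L : ℕ → ℕ → Submodule k (List (Letter i n) →₀ k)} (hL : IsStableFamily L)

include hL

lemma isLeading_mem {d N : ℕ} {l : List (Letter i n)} (h : IsLeading (L d N) l) :
    l ∈ wordSet i n d N := by
  obtain ⟨t, ht, hl, -⟩ := h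
  exact hL.support d N t ht l (Finsupp.mem_support_iff.2 hl)

lemma isLeading_mulWord {d N e : ℕ} {w : List (Fin n → ℕ)} (hw : w.length = N)
    (hwe : ∀ γ ∈ w, ∑ c, γ c = e) {l : List (Letter i n)} (h : IsLeading (L d N) l) :
    IsLeading (L (e + d) N) (mulWord w l) :=
  h.mapDomain (hL.support d N)
    (fun _ hx _ hy hxy => mulWord_lt_mulWord w (hx.1.trans hw.symm) (hy.1.trans hw.symm) hxy)
    (hL.mulWord_mem d N e w hw hwe)

lemma isLeading_insertUnmarked {d N p : ℕ} (hp : p ≤ N) {β : Fin n → ℕ} (hβ : ∑ c, β c = d)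
    {l : List (Letter i n)} (h : IsLeading (L d N) l) :
    IsLeading (insertionSpan d N (L d N)) (insertUnmarked p β l) :=
  h.mapDomain (hL.support d N)
    (fun _ hx _ hy hxy => insertUnmarked_lt p β (hp.trans hx.1.ge) (hp.trans hy.1.ge) hxy)
    (fun t ht => by
      rw [insertionSpan]
      exact Submodule.subset_span ⟨p, hp, β, hβ, t, ht, rfl⟩)

lemma insertionSpan_le (d N : ℕ) : insertionSpan d N (L d N) ≤ L d (N + 1) := by
  rw [insertionSpan, Submodule.span_le]
  rintro _ ⟨p, hp, β, hβ, u, hu, rfl⟩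
  exact hL.insert_mem d N p hp β hβ u hu

/-- A leading word that is a subword of `l` makes `l` a leading word: `l` arises from it by
inserting unmarked letters one at a time. -/
lemma isLeading_of_sublist (d M : ℕ) : ∀ (m l : List (Letter i n)), l ∈ wordSet i n d M →
    m.Sublist l → IsLeading (L d m.length) m → IsLeading (L d M) l ∧
      (m.length < M → ∃ N, M = N + 1 ∧ IsLeading (insertionSpan d N (L d N)) l) := by
  induction M with
  | zero =>
    intro m l hl hml hm
    have h1 : l = [] := List.length_eq_zero_iff.1 hl.1
    subst h1
    obtain rfl := List.sublist_nil.1 hml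
    exact ⟨hm, fun h => absurd h (by simp)⟩
  | succ M ih =>
    intro m l hl hml hm
    rcases (hml.length_le.trans hl.1.le).eq_or_lt with h | h
    · obtain rfl := hml.eq_of_length (h.trans hl.1.symm)
      exact ⟨h ▸ hm, fun h' => absurd h h'.ne⟩
    · have hm' := hL.isLeading_mem hm
      obtain ⟨p, β, l', hp, rfl, hml'⟩ := exists_insertUnmarked_of_sublist hml
        (h.trans_eq hl.1.symm) fun s => (hm'.2.2 s).trans (hl.2.2 s).symm
      obtain ⟨hl', hβ⟩ := (insertUnmarked_mem_wordSet_iff hp).1 hl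
      have h1 := hL.isLeading_insertUnmarked (hp.trans hl'.1.le) hβ (ih m l' hl' hml' hm).1
      refine ⟨?_, fun _ => ⟨M, rfl, h1⟩⟩
      obtain ⟨t, ht, htl⟩ := h1
      exact ⟨t, hL.insertionSpan_le d M ht, htl⟩

/-- A leading word that divides a strictly longer word makes the latter the leading word of an
insertion. -/
lemma isLeading_insertionSpan {d N d' N' : ℕ} (hd : d ≤ d') (hN : N < N')
    {l l' : List (Letter i n)} (hl : IsLeading (L d N) l) (hl' : l' ∈ wordSet i n d' N')
    (h : List.SublistForall₂ Letter.Dvd l l') :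
    ∃ M, N' = M + 1 ∧ IsLeading (insertionSpan d' M (L d' M)) l' := by
  obtain ⟨m, hlm, hml'⟩ := List.sublistForall₂_iff.1 h
  have hlW := hL.isLeading_mem hl
  have hlen := hlm.length_eq
  -- the list of quotients of the letters of `m` by those of `l`
  set w : List (Fin n → ℕ) := List.zipWith (fun a b => b.expo - a.expo) l m with hw
  have hwlen : w.length = N := by simp [hw, ← hlen, hlW.1]
  have hmul : mulWord w l = m := by
    refine List.ext_getElem (by simp [mulWord, hwlen, ← hlen, hlW.1]) fun j h1 h2 => ?_
    have hj : j < l.length := hlen ▸ h2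
    have hdvd := hlm.get hj h2
    simp only [List.get_eq_getElem] at hdvd
    simp only [mulWord, hw, List.getElem_zipWith, Letter.shift]
    rw [tsub_add_cancel_of_le hdvd.2, hdvd.1, Letter.mk_mark_expo]
  have hwe : ∀ γ ∈ w, ∑ c, γ c = d' - d := by
    intro γ hγ
    obtain ⟨j, hj, rfl⟩ := List.mem_iff_getElem.1 hγ
    have hj1 : j < l.length := by rw [hlW.1, ← hwlen]; exact hj
    have hj2 : j < m.length := hlen ▸ hj1
    have hdvd := hlm.get hj1 hj2
    have h1 := hlW.2.1 _ (List.getElem_mem hj1)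
    have h2 := hl'.2.1 _ (hml'.subset (List.getElem_mem hj2))
    unfold Letter.degree at h1 h2
    have h3 : w[j] = m[j].expo - l[j].expo := by simp [hw]
    rw [h3, ← h1, ← h2]
    exact Finset.sum_tsub_distrib _ fun c _ => hdvd.2 c
  have h1 := hL.isLeading_mulWord hwlen hwe hl
  rw [hmul, Nat.sub_add_cancel hd] at h1
  have hmN : m.length = N := by rw [← hlen, hlW.1]
  exact (hL.isLeading_of_sublist d' N' m l' hl' hml' (hmN.symm ▸ h1)).2 (hmN.symm ▸ hN)

/-- Noetherianity: uniformly in `d`, long words of a stable family come from insertions. If not,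
then there are leading words of increasing lengths that are not leading words of insertions, and
by Higman's lemma one of them divides a later one. -/
theorem exists_bound : ∃ C, ∀ d N, C ≤ N → L d (N + 1) ≤ insertionSpan d N (L d N) := by
  by_contra! hcon
  have hbad : ∀ C, ∃ x : ℕ × List (Letter i n), C < x.2.length ∧
      IsLeading (L x.1 x.2.length) x.2 ∧
      ∀ M, x.2.length = M + 1 → ¬ IsLeading (insertionSpan x.1 M (L x.1 M)) x.2 := by
    intro C
    obtain ⟨d, N, hCN, hne⟩ := hcon C
    by_contra! h
    refine hne (le_of_isLeading (wordSet_finite i n d (N + 1)) (hL.support d (N + 1))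
      (hL.insertionSpan_le d N) fun l hl => ?_)
    have hlen := (hL.isLeading_mem hl).1
    obtain ⟨M, hM, hMl⟩ := h (d, l) (by rw [hlen]; omega) (by rw [hlen]; exact hl)
    obtain rfl : M = N := by
      have : l.length = M + 1 := hM
      omega
    exact hMl
  choose bad hbad1 hbad2 hbad3 using hbad
  -- a sequence of such words with strictly increasing lengths
  let f : ℕ → ℕ × List (Letter i n) := fun m => Nat.rec (bad 0) (fun _ x => bad x.2.length) m
  have hf : ∀ m, ∃ C, f m = bad C := by
    intro m
    cases m with
    | zero => exact ⟨0, rfl⟩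
    | succ m => exact ⟨_, rfl⟩
  have hmono : StrictMono fun m => (f m).2.length := strictMono_nat_of_lt_succ fun m =>
    hbad1 (f m).2.length
  have hwqo : WellQuasiOrdered (List.SublistForall₂ (Letter.Dvd (i := i) (n := n))) := by
    rw [← Set.partiallyWellOrderedOn_univ_iff]
    have := Set.PartiallyWellOrderedOn.partiallyWellOrderedOn_sublistForall₂ Letter.Dvd
      (Set.partiallyWellOrderedOn_univ_iff.2 (Letter.wellQuasiOrdered_dvd (i := i) (n := n)))
    simpa using this
  obtain ⟨a, b, hab, h⟩ := (WellQuasiOrdered.prod (wellQuasiOrdered_le (α := ℕ)) hwqo) f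
  obtain ⟨Ca, hCa⟩ := hf a
  obtain ⟨Cb, hCb⟩ := hf b
  have hlt : (f a).2.length < (f b).2.length := hmono hab
  rw [hCa, hCb] at h hlt
  obtain ⟨M, hM, hlead⟩ := hL.isLeading_insertionSpan h.1 hlt (hbad2 Ca)
    (hL.isLeading_mem (hbad2 Cb)) h.2
  exact hbad3 Cb M hM hlead

end IsStableFamily

end Noetherian

end Words

/-! ### Polarization -/

section Polarization

/-- Polarization: a subspace that contains all diagonal values of a multilinear map contains all
its symmetrized values. -/
lemma MultilinearMap.sum_perm_mem {k V E : Type*} [Field k] [AddCommGroup V] [Module k V]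
    [AddCommGroup E] [Module k E] {N : ℕ} (F : MultilinearMap k (fun _ : Fin N => V) E)
    (Z : Submodule k E) (hF : ∀ u, (F fun _ => u) ∈ Z) (w : Fin N → V) :
    ∑ σ : Equiv.Perm (Fin N), F (w ∘ σ) ∈ Z := by
  classical
  have hexp : ∀ J : Finset (Fin N), (F fun _ => ∑ j ∈ J, w j) =
      ∑ r : Fin N → Fin N, if ∀ p, r p ∈ J then F (w ∘ r) else 0 := by
    intro J
    rw [F.map_sum_finset (fun _ j => w j) fun _ => J, ← Finset.sum_filter]
    exact Finset.sum_congr (by ext r; simp [Fintype.mem_piFinset]) fun r _ => rfl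
  -- the alternating sum over `J` leaves only the surjective maps `r`
  have key : ∑ σ : Equiv.Perm (Fin N), F (w ∘ σ) =
      (-1 : k) ^ N • ∑ J : Finset (Fin N), (-1 : k) ^ J.card • F fun _ => ∑ j ∈ J, w j := by
    simp_rw [hexp, Finset.smul_sum]
    rw [Finset.sum_comm]
    refine Finset.sum_of_injOn (fun σ : Equiv.Perm (Fin N) => (σ : Fin N → Fin N))
      (fun _ _ _ _ h => DFunLike.coe_injective h) (fun _ _ => Finset.mem_coe.2 (Finset.mem_univ _))
      (fun r _ hr => ?_) (fun σ _ => ?_)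
    · have hns : ¬ Function.Surjective r := fun hs =>
        hr ⟨Equiv.ofBijective r (Finite.surjective_iff_bijective.1 hs), Finset.mem_coe.2
          (Finset.mem_univ _), rfl⟩
      obtain ⟨a, ha⟩ := not_forall.1 hns
      have hne : ∀ p, r p ≠ a := fun p hp => ha ⟨p, hp⟩
      -- adding or removing an element outside the image of `r` is a sign-reversing involution
      refine Finset.sum_involution (fun J _ => if a ∈ J then J.erase a else insert a J)
        (fun J _ => ?_) (fun J _ _ => ?_) (fun _ _ => Finset.mem_univ _) (fun J _ => ?_)
      · by_cases haJ : a ∈ J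
        · have h1 : (∀ p, r p ∈ J.erase a) ↔ ∀ p, r p ∈ J :=
            forall_congr' fun p => by simp [hne p]
          simp only [if_pos haJ, h1]
          rw [← Finset.card_erase_add_one haJ, pow_succ]
          split_ifs <;> simp
        · have h1 : (∀ p, r p ∈ insert a J) ↔ ∀ p, r p ∈ J :=
            forall_congr' fun p => by simp [hne p]
          simp only [if_neg haJ, h1]
          rw [Finset.card_insert_of_notMem haJ, pow_succ]
          split_ifs <;> simp
      · by_cases haJ : a ∈ J
        · rw [if_pos haJ]
          exact fun h => absurd haJ (h ▸ Finset.notMem_erase a J)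
        · rw [if_neg haJ]
          exact fun h => haJ (h ▸ Finset.mem_insert_self a J)
      · by_cases haJ : a ∈ J
        · simp [haJ, Finset.insert_erase haJ]
        · simp [haJ, Finset.erase_insert haJ]
    · rw [Finset.sum_eq_single Finset.univ]
      · simp [smul_smul, ← mul_pow]
      · intro J _ hJ
        have : ¬ ∀ p, σ p ∈ J := fun h => hJ (Finset.eq_univ_of_forall fun q => by
          simpa using h (σ.symm q))
        rw [if_neg this, smul_zero, smul_zero]
      · simp
  rw [key]
  exact Submodule.smul_mem _ _ (sum_mem fun J _ => Submodule.smul_mem _ _ (hF _))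

end Polarization

/-! ### The map from words to the Koszul complex -/

section WordValue

variable {k : Type u} [Field k] {V : Type v} [AddCommGroup V] [Module k V]
  (I : Ideal (SymmetricAlgebra k V)) {i n : ℕ}

/-- The element of `Λ(V) ⊗ Sym(V) / I` represented by a word, when the monomials are interpreted
as vectors by `b`: letters with positive marks are multiplied in `Λ(V)` in the order of their
marks, and unmarked letters are multiplied in `Sym(V) / I`. -/
noncomputable def wordValue (b : (Fin n → ℕ) → V) (l : List (Letter i n)) :
    KoszulSpace k V (SymmetricAlgebra k V ⧸ I) :=
  ((List.finRange i).map fun s => ExteriorAlgebra.ι k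
    (l.map fun a => if a.mark = s.succ then b a.expo else 0).sum).prod ⊗ₜ
  Ideal.Quotient.mk I
    (l.map fun a => if a.mark = 0 then SymmetricAlgebra.ι k V (b a.expo) else 1).prod

lemma wordValue_perm (b : (Fin n → ℕ) → V) {l l' : List (Letter i n)} (h : l.Perm l') :
    wordValue I b l = wordValue I b l' := by
  unfold wordValue
  congr 2
  · refine List.map_congr_left fun s _ => ?_
    rw [(h.map _).sum_eq]
  · rw [(h.map _).prod_eq]

/-- Inserting an unmarked letter multiplies the represented element by that letter. -/
lemma wordValue_insertUnmarked [FiniteDimensional k V] (b : (Fin n → ℕ) → V) {p : ℕ}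
    (β : Fin n → ℕ)
    {l : List (Letter i n)} (hp : p ≤ l.length) : wordValue I b (insertUnmarked p β l) =
      koszulSMul k _ (SymmetricAlgebra.ι k V (b β)) (wordValue I b l) := by
  rw [wordValue_perm I b (insertUnmarked_perm β hp)]
  unfold wordValue
  rw [koszulSMul_tmul]
  congr 1
  refine congrArg List.prod (List.map_congr_left fun s _ => ?_)
  simp [(Fin.succ_ne_zero s).symm]

lemma length_eq_count_zero_add (l : List (Fin (i + 1))) :
    l.length = l.count 0 + ∑ s : Fin i, l.count s.succ := by
  rw [← Fin.sum_univ_succ fun m => l.count m]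
  induction l with
  | nil => simp
  | cons a l ih => simp [List.count_cons, Finset.sum_add_distrib, ih]

/-- Words in `wordSet i n d N` represent elements of homological degree `i` and internal
degree `N`. -/
lemma wordValue_mem_koszulDegree [FiniteDimensional k V] (J : HomogeneousIdeal (symPow k V))
    (b : (Fin n → ℕ) → V) {d N : ℕ} {l : List (Letter i n)} (hl : l ∈ wordSet i n d N) :
    wordValue J.toIdeal b l ∈ koszulDegree k V (quotientDegree (symPow k V) J) i N := by
  have hcount : i + (l.map Letter.mark).count 0 = N := by
    have h := length_eq_count_zero_add (l.map Letter.mark)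
    simp only [hl.2.2, List.length_map, hl.1, Finset.sum_const, Finset.card_univ,
      Fintype.card_fin, smul_eq_mul, mul_one] at h
    omega
  refine tmul_mem_koszulDegree hcount ?_ ⟨_, ?_, rfl⟩
  · have : ∀ L : List V, (L.map (ExteriorAlgebra.ι k)).prod ∈ ⋀[k]^L.length V := by
      intro L
      rw [ExteriorAlgebra.exteriorPower]
      induction L with
      | nil => simp [Submodule.one_le.1 le_rfl]
      | cons a L ih =>
        rw [List.map_cons, List.prod_cons, List.length_cons, pow_succ']
        exact Submodule.mul_mem_mul ⟨a, rfl⟩ ih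
    have h := this ((List.finRange i).map fun s =>
      (l.map fun a => if a.mark = s.succ then b a.expo else 0).sum)
    rw [List.map_map, List.length_map, List.length_finRange] at h
    exact h
  · clear hcount hl
    unfold symPow
    induction l with
    | nil => simp [Submodule.one_le.1 le_rfl]
    | cons a l ih =>
      simp only [List.map_cons, List.prod_cons, List.count_cons]
      by_cases ha : a.mark = 0
      · simp only [ha, if_true, beq_self_eq_true, pow_succ']
        exact Submodule.mul_mem_mul ⟨_, rfl⟩ ih
      · simpa [ha] using ih

/-- The multilinear map `(v₁, …, v_{i+m}) ↦ v₁ ∧ ⋯ ∧ v_i ⊗ v_{i+1} ⋯ v_{i+m}`. -/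
noncomputable def koszulMulti (i m : ℕ) : MultilinearMap k (fun _ : Fin (i + m) => V)
    (KoszulSpace k V (SymmetricAlgebra k V ⧸ I)) :=
  (LinearMap.lTensor _ (Ideal.Quotient.mkₐ k I).toLinearMap).compMultilinearMap
    (((ExteriorAlgebra.ιMulti k i (M := V)).toMultilinearMap.domCoprod
      ((MultilinearMap.mkPiAlgebra k (Fin m) (SymmetricAlgebra k V)).compLinearMap
        fun _ => SymmetricAlgebra.ι k V)).domDomCongr finSumFinEquiv)

lemma koszulMulti_apply {m : ℕ} (u : Fin (i + m) → V) : koszulMulti I i m u =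
    (List.ofFn fun s => ExteriorAlgebra.ι k (u (Fin.castAdd m s))).prod ⊗ₜ
      Ideal.Quotient.mk I (∏ t, SymmetricAlgebra.ι k V (u (Fin.natAdd i t))) := by
  simp [koszulMulti, ExteriorAlgebra.ιMulti_apply, MultilinearMap.domCoprod_apply]

/-- The word in which the first `i` letters carry the marks `1, …, i` and the others are
unmarked. -/
def standardLetter {i m n : ℕ} (v : Fin (i + m) → Fin n → ℕ) (p : Fin (i + m)) : Letter i n :=
  Letter.mk (Fin.addCases (fun s => s.succ) (fun _ => 0) p) (v p)

lemma wordValue_standard {m : ℕ} (b : (Fin n → ℕ) → V) (v : Fin (i + m) → Fin n → ℕ) :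
    wordValue I b (List.ofFn (standardLetter v)) = koszulMulti I i m fun p => b (v p) := by
  rw [koszulMulti_apply]
  unfold wordValue
  congr 2
  · conv_rhs => rw [List.ofFn_eq_map]
    refine List.map_congr_left fun s _ => ?_
    rw [List.map_ofFn, List.sum_ofFn, Fin.sum_univ_add]
    simp [standardLetter, (Fin.succ_ne_zero s).symm]
  · rw [List.map_ofFn, List.prod_ofFn, Fin.prod_univ_add]
    simp [standardLetter]

lemma symPow_le_span (m : ℕ) : symPow k V m ≤ Submodule.span k
    (Set.range fun u : Fin m → V => ∏ t, SymmetricAlgebra.ι k V (u t)) := by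
  intro s hs
  unfold symPow at hs
  induction hs using Submodule.pow_induction_on_left' with
  | algebraMap r =>
    rw [Algebra.algebraMap_eq_smul_one]
    exact Submodule.smul_mem _ _ (Submodule.subset_span ⟨Fin.elim0, by simp⟩)
  | add x y i hx hy ihx ihy => exact add_mem ihx ihy
  | mem_mul m hm i x hx ih =>
    obtain ⟨v, rfl⟩ := hm
    clear hx
    induction ih using Submodule.span_induction with
    | zero => simp
    | add x y _ _ hx hy => rw [mul_add]; exact add_mem hx hy
    | smul c x _ hx => rw [mul_smul_comm]; exact Submodule.smul_mem _ _ hx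
    | mem x hx =>
      obtain ⟨u, rfl⟩ := hx
      exact Submodule.subset_span ⟨Fin.cons v u, by simp [Fin.prod_univ_succ]⟩

lemma koszulDegree_le_span_koszulMulti [FiniteDimensional k V] (J : HomogeneousIdeal (symPow k V))
    (i m : ℕ) : koszulDegree k V (quotientDegree (symPow k V) J) i (i + m) ≤
      Submodule.span k (Set.range (koszulMulti J.toIdeal i m)) := by
  rw [koszulDegree, Submodule.span_le]
  rintro _ ⟨b, hb, ω, hω, _, ⟨s, hs, rfl⟩, rfl⟩
  obtain rfl : b = m := by omega
  rw [← ExteriorAlgebra.ιMulti_span_fixedDegree] at hω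
  have hs' := symPow_le_span b hs
  clear hs
  rw [SetLike.mem_coe]
  induction hω using Submodule.span_induction with
  | zero => simp
  | add x y _ _ hx hy => rw [TensorProduct.add_tmul]; exact add_mem hx hy
  | smul c x _ hx => rw [← TensorProduct.smul_tmul']; exact Submodule.smul_mem _ _ hx
  | mem x hx =>
    obtain ⟨u, rfl⟩ := hx
    induction hs' using Submodule.span_induction with
    | zero => simp
    | add x y _ _ hx hy => rw [map_add, TensorProduct.tmul_add]; exact add_mem hx hy
    | smul c x _ hx => rw [map_smul, TensorProduct.tmul_smul]; exact Submodule.smul_mem _ _ hx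
    | mem x hx =>
      obtain ⟨u', rfl⟩ := hx
      refine Submodule.subset_span ⟨Fin.append u u', ?_⟩
      rw [koszulMulti_apply, ExteriorAlgebra.ιMulti_apply]
      simp

/-- The values of a multilinear map lie in the span of its values on a finite spanning family. -/
lemma MultilinearMap.mem_span_of_span_eq_top {E A : Type*} [AddCommGroup E] [Module k E] [Finite A]
    {N : ℕ} (F : MultilinearMap k (fun _ : Fin N => V) E) (b : A → V)
    (hb : Submodule.span k (Set.range b) = ⊤) (u : Fin N → V) :
    F u ∈ Submodule.span k (Set.range fun v : Fin N → A => F fun p => b (v p)) := by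
  classical
  have := Fintype.ofFinite A
  have h : ∀ p, ∃ c : A → k, ∑ a, c a • b a = u p := fun p =>
    (Submodule.mem_span_range_iff_exists_fun k).1 (by rw [hb]; trivial)
  choose c hc using h
  have hu : u = fun p => ∑ a, c p a • b a := funext fun p => (hc p).symm
  rw [hu, F.map_sum]
  refine sum_mem fun v _ => ?_
  rw [F.map_smul_univ]
  exact Submodule.smul_mem _ _ (Submodule.subset_span ⟨v, rfl⟩)

end WordValue

/-! ### Multiplication maps between graded pieces -/

section MulMaps

variable {k : Type u} [Field k]

/-- The algebra map `Sym(V) → Sym(W)` induced by a linear map. -/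
noncomputable def symMap {V W : Type*} [AddCommGroup V] [Module k V] [AddCommGroup W] [Module k W]
    (f : V →ₗ[k] W) : SymmetricAlgebra k V →ₐ[k] SymmetricAlgebra k W :=
  SymmetricAlgebra.lift (SymmetricAlgebra.ι k W ∘ₗ f)

@[simp]
lemma symMap_ι {V W : Type*} [AddCommGroup V] [Module k V] [AddCommGroup W] [Module k W]
    (f : V →ₗ[k] W) (x : V) :
    symMap f (SymmetricAlgebra.ι k V x) = SymmetricAlgebra.ι k W (f x) := by
  simp [symMap]

lemma algHom_eq_of_ι {V A : Type*} [AddCommGroup V] [Module k V] [Semiring A] [Algebra k A]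
    (f g : SymmetricAlgebra k V →ₐ[k] A)
    (h : ∀ x, f (SymmetricAlgebra.ι k V x) = g (SymmetricAlgebra.ι k V x))
    (s : SymmetricAlgebra k V) : f s = g s := by
  induction s using SymmetricAlgebra.induction with
  | algebraMap r => rw [f.commutes, g.commutes]
  | ι x => exact h x
  | mul s t hs ht => rw [map_mul, map_mul, hs, ht]
  | add s t hs ht => rw [map_add, map_add, hs, ht]

lemma symMap_mem_symPow {V W : Type*} [AddCommGroup V] [Module k V] [AddCommGroup W] [Module k W]
    (f : V →ₗ[k] W) {m : ℕ} {s : SymmetricAlgebra k V} (hs : s ∈ symPow k V m) :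
    symMap f s ∈ symPow k W m := by
  unfold symPow at hs ⊢
  have h : (LinearMap.range (SymmetricAlgebra.ι k V)).map (symMap f).toLinearMap ≤
      LinearMap.range (SymmetricAlgebra.ι k W) := by
    rintro _ ⟨_, ⟨x, rfl⟩, rfl⟩
    exact ⟨f x, (symMap_ι f x).symm⟩
  have h1 : symMap f s ∈ (LinearMap.range (SymmetricAlgebra.ι k V) ^ m).map
    (symMap f).toLinearMap := ⟨s, hs, rfl⟩
  rw [Submodule.map_pow] at h1
  exact pow_le_pow_left' h m h1

variable {B : Type v} [CommRing B] [Algebra k B] (𝓑 : ℕ → Submodule k B) [GradedAlgebra 𝓑]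

/-- The multiplication map `B_e × B_d → B_{e+d}`. -/
def gradedMul {e d d' : ℕ} (h : e + d = d') : 𝓑 e →ₗ[k] 𝓑 d →ₗ[k] 𝓑 d' :=
  LinearMap.mk₂ k (fun u x => ⟨(u : B) * x, h ▸ SetLike.GradedMul.mul_mem u.2 x.2⟩)
    (fun _ _ _ => Subtype.ext (add_mul _ _ _)) (fun _ _ _ => Subtype.ext (smul_mul_assoc _ _ _))
    (fun _ _ _ => Subtype.ext (mul_add _ _ _)) (fun _ _ _ => Subtype.ext (mul_smul_comm _ _ _))

@[simp]
lemma coe_gradedMul {e d d' : ℕ} (h : e + d = d') (u : 𝓑 e) (x : 𝓑 d) :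
    (gradedMul 𝓑 h u x : B) = u * x := rfl

/-- A family of homogeneous ideals of the algebras `Sym(B_d)` that is carried into itself by
multiplication by elements of `B`. -/
def IsMulStable (I : ∀ d, HomogeneousIdeal (symPow k (𝓑 d))) : Prop :=
  ∀ (e d d' : ℕ) (h : e + d = d') (u : 𝓑 e), ∀ s ∈ (I d).toIdeal,
    symMap (gradedMul 𝓑 h u) s ∈ (I d').toIdeal

lemma homogeneousCore_map_mem {V W : Type*} [AddCommGroup V] [Module k V] [AddCommGroup W]
    [Module k W] (f : V →ₗ[k] W) (I : Ideal (SymmetricAlgebra k V))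
    (J : Ideal (SymmetricAlgebra k W))
    (h : ∀ m, ∀ s ∈ symPow k V m, s ∈ I → symMap f s ∈ J) {s : SymmetricAlgebra k V}
    (hs : s ∈ (I.homogeneousCore (symPow k V)).toIdeal) :
    symMap f s ∈ (J.homogeneousCore (symPow k W)).toIdeal := by
  classical
  rw [← DirectSum.sum_support_decompose (symPow k V) s, map_sum]
  refine sum_mem fun m _ => ?_
  have h1 := (I.homogeneousCore (symPow k V)).isHomogeneous m hs
  refine (mem_homogeneousCore_iff (symPow k W) J
    (symMap_mem_symPow f (SetLike.coe_mem _))).2 (h m _ (SetLike.coe_mem _) ?_)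
  exact Ideal.toIdeal_homogeneousCore_le _ _ h1

lemma veroneseMul_symMap {e d d' : ℕ} (h : e + d = d') (u : 𝓑 e) {m : ℕ}
    {s : SymmetricAlgebra k (𝓑 d)} (hs : s ∈ symPow k (𝓑 d) m) :
    veroneseMul 𝓑 d' (symMap (gradedMul 𝓑 h u) s) = (u : B) ^ m * veroneseMul 𝓑 d s := by
  unfold symPow at hs
  induction hs using Submodule.pow_induction_on_left' with
  | algebraMap r => simp
  | add x y i hx hy ihx ihy => rw [map_add, map_add, ihx, ihy, map_add, mul_add]
  | mem_mul y hy i x hx ih =>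
    obtain ⟨y, rfl⟩ := hy
    rw [map_mul, map_mul, ih, map_mul]
    simp [veroneseMul]
    ring

variable {𝓑} in
/-- The map `Sym(B_d) / I_d → Sym(B_{e+d}) / I_{e+d}` induced by multiplication by `u ∈ B_e`. -/
noncomputable def IsMulStable.quotientMul {I : ∀ d, HomogeneousIdeal (symPow k (𝓑 d))}
    (hI : IsMulStable 𝓑 I) {e d d' : ℕ} (h : e + d = d') (u : 𝓑 e) :
    (SymmetricAlgebra k (𝓑 d) ⧸ (I d).toIdeal) →ₐ[k] SymmetricAlgebra k (𝓑 d') ⧸ (I d').toIdeal :=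
  Ideal.quotientMapₐ (I d').toIdeal (symMap (gradedMul 𝓑 h u)) (hI e d d' h u)

lemma IsMulStable.quotientMul_ι {I : ∀ d, HomogeneousIdeal (symPow k (𝓑 d))}
    (hI : IsMulStable 𝓑 I) {e d d' : ℕ} (h : e + d = d') (u : 𝓑 e) (x : 𝓑 d) :
    hI.quotientMul h u (Ideal.Quotient.mk _ (SymmetricAlgebra.ι k _ x)) =
      Ideal.Quotient.mk _ (SymmetricAlgebra.ι k _ (gradedMul 𝓑 h u x)) :=
  congrArg (Ideal.Quotient.mk (I d').toIdeal) (symMap_ι _ x)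

/-- The comultiplication of the symmetric algebra is natural. -/
lemma secantComul_symMap {e d d' : ℕ} (h : e + d = d') (u : 𝓑 e)
    (I J : ∀ d, HomogeneousIdeal (symPow k (𝓑 d))) (hI : IsMulStable 𝓑 I) (hJ : IsMulStable 𝓑 J)
    (s : SymmetricAlgebra k (𝓑 d)) :
    secantComul 𝓑 d' (I d') (J d') (symMap (gradedMul 𝓑 h u) s) =
      Algebra.TensorProduct.map
        (hI.quotientMul h u)
        (hJ.quotientMul h u)
        (secantComul 𝓑 d (I d) (J d) s) := by
  refine algHom_eq_of_ι (secantComul 𝓑 d' (I d') (J d') |>.comp (symMap (gradedMul 𝓑 h u)))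
    ((Algebra.TensorProduct.map _ _).comp (secantComul 𝓑 d (I d) (J d))) (fun x => ?_) s
  simp [secantComul, IsMulStable.quotientMul_ι]

/-- The secant ideals are stable under multiplication by elements of `B`. -/
lemma isMulStable_secantIdeal {r : ℕ} (hr : 1 ≤ r) :
    IsMulStable 𝓑 fun d => secantIdeal 𝓑 d r := by
  obtain ⟨r, rfl⟩ := Nat.exists_eq_add_of_le' hr
  clear hr
  have h1 : IsMulStable 𝓑 fun d => veroneseIdeal 𝓑 d := by
    intro e d d' h u s hs
    refine homogeneousCore_map_mem _ _ _ (fun m t ht ht0 => ?_) hs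
    rw [RingHom.mem_ker] at ht0 ⊢
    rw [veroneseMul_symMap 𝓑 h u ht, ht0, mul_zero]
  induction r with
  | zero => exact h1
  | succ r ih =>
    intro e d d' h u s hs
    refine homogeneousCore_map_mem _ _ _ (fun m t ht ht0 => ?_) hs
    rw [RingHom.mem_ker] at ht0 ⊢
    rw [secantComul_symMap 𝓑 h u _ _ h1 ih, ht0, map_zero]

end MulMaps

/-! ### Monomials in elements of degree one -/

section Monomials

variable {k : Type u} [Field k] {B : Type v} [CommRing B] [Algebra k B] (𝓑 : ℕ → Submodule k B)
  [GradedAlgebra 𝓑]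

variable {n : ℕ} (x : Fin n → 𝓑 1)

lemma prod_pow_mem (α : Fin n → ℕ) : ∏ c, (x c : B) ^ α c ∈ 𝓑 (∑ c, α c) := by
  have := SetLike.prod_mem_graded 𝓑 (fun c => α c) (fun c => (x c : B) ^ α c)
    (F := Finset.univ) fun c _ => by simpa using SetLike.pow_mem_graded (α c) (x c).2
  exact this

/-- The monomial with exponent vector `α` in elements `x c` of `B_1`, as a vector of `B_d`. It is
taken to be `0` unless the degree of `α` is `d`. -/
def monomialVec (d : ℕ) (α : Fin n → ℕ) : 𝓑 d :=
  if h : ∑ c, α c = d then ⟨∏ c, (x c : B) ^ α c, h ▸ prod_pow_mem 𝓑 x α⟩ else 0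

lemma monomialVec_add {e d d' : ℕ} (h : e + d = d') {γ α : Fin n → ℕ} (hγ : ∑ c, γ c = e)
    (hα : ∑ c, α c = d) : monomialVec 𝓑 x d' (γ + α) =
      gradedMul 𝓑 h (monomialVec 𝓑 x e γ) (monomialVec 𝓑 x d α) := by
  have h1 : ∑ c, (γ + α) c = d' := by simp [Finset.sum_add_distrib, hγ, hα, h]
  refine Subtype.ext ?_
  rw [coe_gradedMul]
  simp [monomialVec, hγ, hα, pow_add, Finset.prod_mul_distrib,
    show ∑ c, (γ c + α c) = d' from h1]

variable (hx : Submodule.span k (Set.range x) = ⊤) (hgen : Algebra.adjoin k (𝓑 1 : Set B) = ⊤)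

include hx hgen in
/-- If `B` is generated by `B_1`, then the monomials of degree `d` in a spanning family of `B_1`
span `B_d`. -/
lemma span_monomialVec (d : ℕ) :
    Submodule.span k (Set.range fun α : {α : Fin n → ℕ // ∑ c, α c = d} =>
      monomialVec 𝓑 x d α) = ⊤ := by
  classical
  rw [eq_top_iff]
  rintro y -
  have hadj : Algebra.adjoin k (Set.range fun c => (x c : B)) = ⊤ := by
    rw [eq_top_iff, ← hgen]
    refine Algebra.adjoin_le fun z hz => ?_
    have hz' : (⟨z, hz⟩ : 𝓑 1) ∈ Submodule.span k (Set.range x) := by rw [hx]; trivial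
    have h1 := Submodule.mem_map_of_mem (f := (𝓑 1).subtype) hz'
    rw [Submodule.map_span, ← Set.range_comp] at h1
    exact Algebra.span_le_adjoin k _ h1
  have hy : (y : B) ∈ (MvPolynomial.aeval fun c => (x c : B)).range (R := k) := by
    rw [← Algebra.adjoin_range_eq_range_aeval, hadj]
    trivial
  obtain ⟨P, hP⟩ := hy
  have hdec : y = ∑ α ∈ P.support, P.coeff α • monomialVec 𝓑 x d α := by
    refine Subtype.ext ?_
    have h1 : (y : B) = DirectSum.decompose 𝓑 (y : B) d := by
      rw [DirectSum.decompose_of_mem_same _ y.2]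
    have h2 : (y : B) = ∑ α ∈ P.support, P.coeff α • ∏ c, (x c : B) ^ α c := by
      rw [← hP]
      change MvPolynomial.aeval _ P = _
      rw [MvPolynomial.aeval_def, MvPolynomial.eval₂_eq']
      simp only [Algebra.smul_def]
    rw [h1, h2, DirectSum.decompose_sum, DFinsupp.finsetSum_apply]
    simp only [AddSubmonoidClass.coe_finsetSum]
    refine Finset.sum_congr rfl fun α _ => ?_
    rw [DirectSum.decompose_smul, DirectSum.smul_apply, Submodule.coe_smul, Submodule.coe_smul]
    congr 1
    by_cases h : ∑ c, α c = d
    · subst h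
      rw [DirectSum.decompose_of_mem_same _ (prod_pow_mem 𝓑 x α)]
      simp [monomialVec]
    · rw [DirectSum.decompose_of_mem_ne _ (prod_pow_mem 𝓑 x α) h]
      simp [monomialVec, h]
  rw [hdec]
  refine sum_mem fun α _ => Submodule.smul_mem _ _ ?_
  by_cases h : ∑ c, α c = d
  · exact Submodule.subset_span ⟨⟨α, h⟩, rfl⟩
  · simp [monomialVec, h]

include hx hgen in
lemma finiteDimensional_of_adjoin_eq_top (d : ℕ) : FiniteDimensional k (𝓑 d) := by
  have : Finite {α : Fin n → ℕ // ∑ c, α c = d} := finite_setOf_sum_eq n d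
  exact ⟨Submodule.fg_def.2 ⟨_, Set.finite_range _, span_monomialVec 𝓑 x hx hgen d⟩⟩

end Monomials

/-! ### Koszul cycles as a stable family of words -/

section Cycles

variable {k : Type u} [Field k] {B : Type v} [CommRing B] [Algebra k B] (𝓑 : ℕ → Submodule k B)
  [GradedAlgebra 𝓑] {I : ∀ d, HomogeneousIdeal (symPow k (𝓑 d))}

/-- Multiplication by `u ∈ B_e` as a map from the Koszul complex of `Sym(B_d) / I_d` to that of
`Sym(B_{e+d}) / I_{e+d}`. -/
noncomputable def koszulMul (hI : IsMulStable 𝓑 I) {e d d' : ℕ} (h : e + d = d') (u : 𝓑 e) :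
    KoszulSpace k (𝓑 d) (SymmetricAlgebra k (𝓑 d) ⧸ (I d).toIdeal) →ₗ[k]
      KoszulSpace k (𝓑 d') (SymmetricAlgebra k (𝓑 d') ⧸ (I d').toIdeal) :=
  TensorProduct.map (ExteriorAlgebra.map (gradedMul 𝓑 h u)).toLinearMap
    (hI.quotientMul h u).toLinearMap

lemma koszulMul_koszulMulti (hI : IsMulStable 𝓑 I) {e d d' : ℕ} (h : e + d = d') (u : 𝓑 e)
    {i m : ℕ} (v : Fin (i + m) → 𝓑 d) :
    koszulMul 𝓑 hI h u (koszulMulti (I d).toIdeal i m v) =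
      koszulMulti (I d').toIdeal i m fun p => gradedMul 𝓑 h u (v p) := by
  rw [koszulMulti_apply, koszulMulti_apply, koszulMul, TensorProduct.map_tmul]
  congr 1
  · simp [map_list_prod, List.map_ofFn, Function.comp_def]
  · simp [IsMulStable.quotientMul_ι]

variable [∀ d, FiniteDimensional k (𝓑 d)]

lemma koszulD_koszulMul (hI : IsMulStable 𝓑 I) {e d d' : ℕ} (h : e + d = d') (u : 𝓑 e)
    (z : KoszulSpace k (𝓑 d) (SymmetricAlgebra k (𝓑 d) ⧸ (I d).toIdeal)) :
    koszulD k _ _ (koszulMul 𝓑 hI h u z) = koszulMul 𝓑 hI h u (koszulD k _ _ z) := by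
  refine koszulD_map _ _ (fun v y => ?_) z
  change hI.quotientMul h u (Ideal.Quotient.mk _ (SymmetricAlgebra.ι k _ v) * y) =
    Ideal.Quotient.mk _ (SymmetricAlgebra.ι k _ (gradedMul 𝓑 h u v)) * hI.quotientMul h u y
  rw [map_mul, IsMulStable.quotientMul_ι]

variable {n : ℕ} (x : Fin n → 𝓑 1) (I) (i : ℕ)

/-- The linear map from combinations of words to the Koszul complex of `Sym(B_d) / I_d`, with
letters interpreted as monomials in the elements `x c` of `B_1`. -/
noncomputable def wordMap (d : ℕ) : (List (Letter i n) →₀ k) →ₗ[k]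
    KoszulSpace k (𝓑 d) (SymmetricAlgebra k (𝓑 d) ⧸ (I d).toIdeal) :=
  Finsupp.linearCombination k (wordValue (I d).toIdeal (monomialVec 𝓑 x d))

variable {i}

lemma wordMap_mapDomain_insertUnmarked {d p : ℕ} (β : Fin n → ℕ) (t : List (Letter i n) →₀ k)
    (ht : ∀ l ∈ t.support, p ≤ l.length) :
    wordMap 𝓑 I x i d (Finsupp.mapDomain (insertUnmarked p β) t) =
      koszulSMul k _ (SymmetricAlgebra.ι k _ (monomialVec 𝓑 x d β)) (wordMap 𝓑 I x i d t) := by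
  rw [wordMap, Finsupp.linearCombination_mapDomain, Finsupp.linearCombination_apply,
    Finsupp.linearCombination_apply, Finsupp.sum, Finsupp.sum, map_sum]
  refine Finset.sum_congr rfl fun l hl => ?_
  rw [map_smul, Function.comp_apply, wordValue_insertUnmarked _ _ _ (ht l hl)]

lemma wordMap_mem_koszulDegree {d N : ℕ} (t : List (Letter i n) →₀ k)
    (ht : ∀ l ∈ t.support, l ∈ wordSet i n d N) :
    wordMap 𝓑 I x i d t ∈ koszulDegree k (𝓑 d) (quotientDegree (symPow k (𝓑 d)) (I d)) i N := by
  rw [wordMap, Finsupp.linearCombination_apply]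
  exact sum_mem fun l hl => Submodule.smul_mem _ _ (wordValue_mem_koszulDegree _ _ (ht l hl))

variable (i)

/-- The combinations of words that represent Koszul cycles, and continue to do so after letterwise
multiplication by arbitrary monomials of equal degree. -/
def cyclesFamily (d N : ℕ) : Submodule k (List (Letter i n) →₀ k) where
  carrier := {t | (∀ l ∈ t.support, l ∈ wordSet i n d N) ∧
    ∀ (e d' : ℕ) (_ : e + d = d') (w : List (Fin n → ℕ)), w.length = N →
      (∀ γ ∈ w, ∑ c, γ c = e) →
        koszulD k _ _ (wordMap 𝓑 I x i d' (Finsupp.mapDomain (mulWord w) t)) = 0}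
  zero_mem' := ⟨by simp, fun e d' h w hw hwe => by
    rw [Finsupp.mapDomain_zero, LinearMap.map_zero, LinearMap.map_zero]⟩
  add_mem' := by
    classical
    rintro s t ⟨hs, hs'⟩ ⟨ht, ht'⟩
    refine ⟨fun l hl => ?_, fun e d' h w hw hwe => ?_⟩
    · exact (Finset.mem_union.1 (Finsupp.support_add hl)).elim (hs l) (ht l)
    · rw [Finsupp.mapDomain_add, map_add, map_add, hs' e d' h w hw hwe, ht' e d' h w hw hwe,
        add_zero]
  smul_mem' := by
    rintro c t ⟨ht, ht'⟩
    refine ⟨fun l hl => ht l (Finsupp.support_smul hl), fun e d' h w hw hwe => ?_⟩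
    rw [Finsupp.mapDomain_smul, map_smul, map_smul, ht' e d' h w hw hwe, smul_zero]

variable {i}

lemma koszulD_wordMap_of_mem_cyclesFamily {d N : ℕ} {t : List (Letter i n) →₀ k}
    (ht : t ∈ cyclesFamily 𝓑 I x i d N) : koszulD k _ _ (wordMap 𝓑 I x i d t) = 0 := by
  have h := ht.2 0 d (zero_add d) (List.replicate N 0) (by simp) fun γ hγ => by
    simp [List.eq_of_mem_replicate hγ]
  rwa [Finsupp.mapDomain_congr (g := id), Finsupp.mapDomain_id] at h
  intro l hl
  rw [← (ht.1 l hl).1, mulWord_replicate_zero, id]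

lemma isStableFamily_cyclesFamily : IsStableFamily (cyclesFamily 𝓑 I x i) where
  support d N t ht := ht.1
  mulWord_mem d N e w hw hwe t ht := by
    classical
    refine ⟨fun l hl => ?_, fun e' d' h w' hw' hwe' => ?_⟩
    · obtain ⟨l', hl', rfl⟩ := Finset.mem_image.1 (Finsupp.mapDomain_support hl)
      exact mulWord_mem_wordSet hw hwe (ht.1 l' hl')
    · rw [← Finsupp.mapDomain_comp, show (mulWord w' ∘ mulWord w : List (Letter i n) → _) =
        mulWord (List.zipWith (· + ·) w' w) from funext fun l => mulWord_mulWord w w' l]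
      refine ht.2 (e' + e) d' (by omega) _ (by simp [hw, hw']) fun γ hγ => ?_
      obtain ⟨j, hj, rfl⟩ := List.mem_iff_getElem.1 hγ
      simp [Finset.sum_add_distrib, hwe _ (List.getElem_mem _), hwe' _ (List.getElem_mem _)]
  insert_mem d N p hp β hβ t ht := by
    classical
    refine ⟨fun l hl => ?_, fun e d' h w hw hwe => ?_⟩
    · obtain ⟨l', hl', rfl⟩ := Finset.mem_image.1 (Finsupp.mapDomain_support hl)
      exact (insertUnmarked_mem_wordSet_iff (hp.trans (ht.1 l' hl').1.ge)).2 ⟨ht.1 l' hl', hβ⟩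
    · obtain ⟨γ, hγ, w', hw', hsub, hins⟩ := exists_mulWord_insertUnmarked (i := i) w hw hp
      have h1 : Finsupp.mapDomain (mulWord w) (Finsupp.mapDomain (insertUnmarked p β) t) =
          Finsupp.mapDomain (insertUnmarked p (γ + β)) (Finsupp.mapDomain (mulWord w') t) := by
        rw [← Finsupp.mapDomain_comp, ← Finsupp.mapDomain_comp]
        exact Finsupp.mapDomain_congr fun l hl => hins β l (ht.1 l hl).1
      rw [h1, wordMap_mapDomain_insertUnmarked, koszulD_smul,
        ht.2 e d' h w' hw' fun δ hδ => hwe δ (hsub δ hδ), LinearMap.map_zero]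
      intro l hl
      obtain ⟨l', hl', rfl⟩ := Finset.mem_image.1 (Finsupp.mapDomain_support hl)
      simp [mulWord, hw', (ht.1 l' hl').1, hp]

/-- Combinations of words that come from insertions represent Koszul boundaries, because
multiplication by `v` is homotopic to zero on the Koszul complex by means of `v ∧ ·`. -/
lemma exists_koszulD_eq_wordMap {d N : ℕ} {t : List (Letter i n) →₀ k}
    (ht : t ∈ insertionSpan d N (cyclesFamily 𝓑 I x i d N)) :
    ∃ y ∈ koszulDegree k (𝓑 d) (quotientDegree (symPow k (𝓑 d)) (I d)) (i + 1) (N + 1),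
      koszulD k _ _ y = wordMap 𝓑 I x i d t := by
  unfold insertionSpan at ht
  induction ht using Submodule.span_induction with
  | zero => exact ⟨0, zero_mem _, by simp⟩
  | add s t _ _ hs ht =>
    obtain ⟨y, hy, hys⟩ := hs
    obtain ⟨y', hy', hyt⟩ := ht
    exact ⟨y + y', add_mem hy hy', by simp [hys, hyt]⟩
  | smul c t _ ht =>
    obtain ⟨y, hy, hyt⟩ := ht
    exact ⟨c • y, Submodule.smul_mem _ _ hy, by simp [hyt]⟩
  | mem t ht =>
    obtain ⟨p, hp, β, hβ, u, hu, rfl⟩ := ht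
    refine ⟨koszulWedge k _ (monomialVec 𝓑 x d β) (wordMap 𝓑 I x i d u),
      koszulWedge_mem_koszulDegree _ (wordMap_mem_koszulDegree 𝓑 I x u hu.1), ?_⟩
    rw [koszulD_wedge, koszulD_wordMap_of_mem_cyclesFamily 𝓑 I x hu, map_zero, sub_zero,
      wordMap_mapDomain_insertUnmarked]
    exact fun l hl => hp.trans (hu.1 l hl).1.ge

end Cycles

/-! ### Koszul cycles come from words -/

section Surjectivity

lemma ofFn_standardLetter_mem_wordSet {i m n d : ℕ} {v : Fin (i + m) → Fin n → ℕ}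
    (hv : ∀ p, ∑ c, v p c = d) : List.ofFn (standardLetter v) ∈ wordSet i n d (i + m) := by
  refine ⟨List.length_ofFn, fun a ha => ?_, fun s => ?_⟩
  · obtain ⟨p, rfl⟩ := List.mem_ofFn.1 ha
    exact hv p
  · rw [List.map_ofFn, List.ofFn_add, List.count_append]
    have h1 : (List.ofFn fun t : Fin i =>
        (Letter.mark ∘ standardLetter v) (Fin.castAdd m t)) = List.ofFn Fin.succ := by
      simp [standardLetter]
    have h2 : (List.ofFn fun t : Fin m =>
        (Letter.mark ∘ standardLetter v) (Fin.natAdd i t)) = List.replicate m 0 := by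
      simp [standardLetter]
    have h3 : (List.replicate m (0 : Fin (i + 1))).count s.succ = 0 := by
      simp [List.count_replicate, (Fin.succ_ne_zero s).symm]
    have h4 : (List.ofFn (Fin.succ (n := i))).count s.succ = 1 :=
      List.count_eq_one_of_mem (List.nodup_ofFn.2 (Fin.succ_injective i))
        (List.mem_ofFn.2 ⟨s, rfl⟩)
    exact (congrArg₂ (· + ·) (congrArg (List.count s.succ) h1)
      (congrArg (List.count s.succ) h2)).trans (by rw [h3, h4])

lemma mulWord_ofFn_standardLetter {i m n : ℕ} (γ : Fin (i + m) → Fin n → ℕ)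
    (v : Fin (i + m) → Fin n → ℕ) (σ : Equiv.Perm (Fin (i + m))) :
    mulWord (List.ofFn γ) (List.ofFn (standardLetter v ∘ σ)) =
      List.ofFn (standardLetter (fun p => γ (σ.symm p) + v p) ∘ σ) := by
  refine List.ext_getElem (by simp [mulWord]) fun j h1 h2 => ?_
  simp [mulWord, standardLetter, Letter.shift]

variable {k : Type u} [Field k] {B : Type v} [CommRing B] [Algebra k B] (𝓑 : ℕ → Submodule k B)
  [GradedAlgebra 𝓑] {I : ∀ d, HomogeneousIdeal (symPow k (𝓑 d))}
  [∀ d, FiniteDimensional k (𝓑 d)] {n : ℕ} (x : Fin n → 𝓑 1)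

/-- The sum of all words obtained from the standard word of `v` by permuting the positions. -/
noncomputable def symmetrizedWord (k : Type u) [Field k] {i m n : ℕ}
    (v : Fin (i + m) → Fin n → ℕ) : List (Letter i n) →₀ k :=
  ∑ σ : Equiv.Perm (Fin (i + m)), Finsupp.single (List.ofFn (standardLetter v ∘ σ)) 1

lemma symmetrizedWord_mem_supported {i m d : ℕ} {v : Fin (i + m) → Fin n → ℕ}
    (hv : ∀ p, ∑ c, v p c = d) :
    symmetrizedWord k v ∈ Finsupp.supported k k (wordSet i n d (i + m)) := by
  refine sum_mem fun σ _ => Finsupp.single_mem_supported _ _ ?_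
  have hmem := ofFn_standardLetter_mem_wordSet hv
  have hperm := Equiv.Perm.ofFn_comp_perm σ (standardLetter v)
  refine ⟨by simp, fun a ha => hmem.2.1 a (hperm.mem_iff.1 ha), fun s => ?_⟩
  rw [(hperm.map _).count_eq]
  exact hmem.2.2 s

lemma wordMap_single_ofFn_comp_perm {i m d : ℕ} (v : Fin (i + m) → Fin n → ℕ)
    (σ : Equiv.Perm (Fin (i + m))) :
    wordMap 𝓑 I x i d (Finsupp.single (List.ofFn (standardLetter v ∘ σ)) 1) =
      koszulMulti (I d).toIdeal i m fun p => monomialVec 𝓑 x d (v p) := by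
  rw [wordMap, Finsupp.linearCombination_single, one_smul,
    wordValue_perm _ _ (Equiv.Perm.ofFn_comp_perm σ _), wordValue_standard]

lemma wordMap_symmetrizedWord {i m d : ℕ} (v : Fin (i + m) → Fin n → ℕ) :
    wordMap 𝓑 I x i d (symmetrizedWord k v) = ((i + m).factorial : k) •
      koszulMulti (I d).toIdeal i m fun p => monomialVec 𝓑 x d (v p) := by
  rw [symmetrizedWord, map_sum,
    Finset.sum_congr rfl fun σ _ => wordMap_single_ofFn_comp_perm 𝓑 x v σ, Finset.sum_const,
    Finset.card_univ, Fintype.card_perm, Fintype.card_fin, Nat.cast_smul_eq_nsmul]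

lemma wordMap_mapDomain_symmetrizedWord {i m e d d' : ℕ} (h : e + d = d')
    {γ v : Fin (i + m) → Fin n → ℕ} (hγ : ∀ p, ∑ c, γ p c = e) (hv : ∀ p, ∑ c, v p c = d) :
    wordMap 𝓑 I x i d' (Finsupp.mapDomain (mulWord (List.ofFn γ)) (symmetrizedWord k v)) =
      ∑ σ : Equiv.Perm (Fin (i + m)), koszulMulti (I d').toIdeal i m fun p =>
        gradedMul 𝓑 h (monomialVec 𝓑 x e (γ (σ p))) (monomialVec 𝓑 x d (v p)) := by
  rw [← Equiv.sum_comp (Equiv.inv (Equiv.Perm (Fin (i + m)))), symmetrizedWord,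
    Finsupp.mapDomain_finsetSum, map_sum]
  refine Finset.sum_congr rfl fun σ _ => ?_
  rw [Finsupp.mapDomain_single, mulWord_ofFn_standardLetter, wordMap_single_ofFn_comp_perm]
  congr 1
  funext p
  exact monomialVec_add 𝓑 x h (hγ _) (hv p)

lemma wordMap_mapDomain_sum_symmetrizedWord {A : Type*} (s : Finset A) (a : A → k) {i m e d d' : ℕ}
    (h : e + d = d') {γ : Fin (i + m) → Fin n → ℕ} (hγ : ∀ p, ∑ c, γ p c = e)
    {v : A → Fin (i + m) → Fin n → ℕ} (hv : ∀ y p, ∑ c, v y p c = d) :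
    wordMap 𝓑 I x i d' (Finsupp.mapDomain (mulWord (List.ofFn γ))
      (∑ y ∈ s, a y • symmetrizedWord k (v y))) =
      ∑ σ : Equiv.Perm (Fin (i + m)), ∑ y ∈ s, a y • koszulMulti (I d').toIdeal i m fun p =>
        gradedMul 𝓑 h (monomialVec 𝓑 x e (γ (σ p))) (monomialVec 𝓑 x d (v y p)) := by
  rw [Finset.sum_comm, Finsupp.mapDomain_finsetSum, map_sum]
  refine Finset.sum_congr rfl fun y _ => ?_
  rw [Finsupp.mapDomain_smul, LinearMap.map_smul, ← Finset.smul_sum,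
    wordMap_mapDomain_symmetrizedWord 𝓑 x h hγ (hv y)]

/-- Symmetrized representatives of Koszul cycles belong to `cyclesFamily`: letterwise
multiplication by monomials yields a symmetrized value of a multilinear map whose diagonal values
are the products of the cycle with elements of `B`. -/
lemma sum_symmetrizedWord_mem_cyclesFamily (hI : IsMulStable 𝓑 I) {A : Type*} (s : Finset A)
    (a : A → k) {i m d : ℕ} {v : A → Fin (i + m) → Fin n → ℕ} (hv : ∀ y p, ∑ c, v y p c = d)
    (hD : koszulD k _ _ (∑ y ∈ s, a y •
      koszulMulti (I d).toIdeal i m fun p => monomialVec 𝓑 x d (v y p)) = 0) :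
    ∑ y ∈ s, a y • symmetrizedWord k (v y) ∈ cyclesFamily 𝓑 I x i d (i + m) := by
  refine ⟨?_, fun e d' h w hw hwe => ?_⟩
  · have hsupp : ∑ y ∈ s, a y • symmetrizedWord k (v y) ∈
        Finsupp.supported k k (wordSet i n d (i + m)) :=
      sum_mem fun y _ => Submodule.smul_mem _ _ (symmetrizedWord_mem_supported (hv y))
    exact fun l hl => hsupp hl
  · obtain ⟨γ, rfl⟩ : ∃ γ : Fin (i + m) → Fin n → ℕ, w = List.ofFn γ :=
      ⟨fun p => w.get (p.cast hw.symm), List.ext_getElem (by simp [hw]) fun j _ _ => by simp⟩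
    have hγ : ∀ p, ∑ c, γ p c = e := fun p => hwe _ (List.mem_ofFn.2 ⟨p, rfl⟩)
    let F : MultilinearMap k (fun _ : Fin (i + m) => 𝓑 e)
        (KoszulSpace k (𝓑 d') (SymmetricAlgebra k (𝓑 d') ⧸ (I d').toIdeal)) :=
      ∑ y ∈ s, a y • (koszulMulti (I d').toIdeal i m).compLinearMap fun p =>
        (gradedMul 𝓑 h).flip (monomialVec 𝓑 x d (v y p))
    have hFapp : ∀ u, F u = ∑ y ∈ s, a y • koszulMulti (I d').toIdeal i m fun p =>
        gradedMul 𝓑 h (u p) (monomialVec 𝓑 x d (v y p)) := fun u => sum_apply ..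
    have hF : ∀ u, (F fun _ => u) ∈ LinearMap.ker (koszulD k (𝓑 d') _) := by
      intro u
      have hdiag : (F fun _ => u) = koszulMul 𝓑 hI h u (∑ y ∈ s, a y •
          koszulMulti (I d).toIdeal i m fun p => monomialVec 𝓑 x d (v y p)) := by
        rw [hFapp, map_sum]
        refine Finset.sum_congr rfl fun y _ => ?_
        rw [LinearMap.map_smul, koszulMul_koszulMulti]
      rw [LinearMap.mem_ker, hdiag, koszulD_koszulMul, hD, LinearMap.map_zero]
    have hsum := MultilinearMap.sum_perm_mem F _ hF fun p => monomialVec 𝓑 x e (γ p)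
    rw [Finset.sum_congr rfl fun σ _ => hFapp _] at hsum
    rw [wordMap_mapDomain_sum_symmetrizedWord 𝓑 x s a h hγ hv]
    exact hsum

/-- In characteristic zero every Koszul cycle of degree `j ≥ i` is represented by an element of
`cyclesFamily`, namely by the average of any representative over all permutations of the
positions. -/
theorem exists_mem_cyclesFamily_wordMap_eq [CharZero k] (hI : IsMulStable 𝓑 I)
    (hx : Submodule.span k (Set.range x) = ⊤) (hgen : Algebra.adjoin k (𝓑 1 : Set B) = ⊤)
    {i m d : ℕ} {z : KoszulSpace k (𝓑 d) (SymmetricAlgebra k (𝓑 d) ⧸ (I d).toIdeal)}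
    (hz : z ∈ koszulDegree k (𝓑 d) (quotientDegree (symPow k (𝓑 d)) (I d)) i (i + m))
    (hDz : koszulD k _ _ z = 0) :
    ∃ t ∈ cyclesFamily 𝓑 I x i d (i + m), wordMap 𝓑 I x i d t = z := by
  have : Finite {α : Fin n → ℕ // ∑ c, α c = d} := finite_setOf_sum_eq n d
  have hz' : z ∈ Submodule.span k (Set.range
      fun v : Fin (i + m) → {α : Fin n → ℕ // ∑ c, α c = d} =>
        koszulMulti (I d).toIdeal i m fun p => monomialVec 𝓑 x d (v p)) := by
    refine Submodule.span_le.2 ?_ (koszulDegree_le_span_koszulMulti (I d) i m hz)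
    rintro _ ⟨y, rfl⟩
    exact MultilinearMap.mem_span_of_span_eq_top _ _ (span_monomialVec 𝓑 x hx hgen d) y
  obtain ⟨c, hc⟩ := Finsupp.mem_span_range_iff_exists_finsupp.1 hz'
  rw [Finsupp.sum] at hc
  have hfac : ((i + m).factorial : k) ≠ 0 := by exact_mod_cast (i + m).factorial_ne_zero
  have hmem := sum_symmetrizedWord_mem_cyclesFamily 𝓑 x hI c.support c
    (v := fun v p => (v p).1) (fun v p => (v p).2) (hc.symm ▸ hDz)
  refine ⟨_, Submodule.smul_mem _ ((i + m).factorial : k)⁻¹ hmem, ?_⟩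
  rw [LinearMap.map_smul, map_sum, inv_smul_eq_iff₀ hfac, ← hc, Finset.smul_sum]
  refine Finset.sum_congr rfl fun v _ => ?_
  rw [LinearMap.map_smul, wordMap_symmetrizedWord, smul_comm]

/-! ### Uniform bounds -/

/-- For a family of ideals that is stable under multiplication by `B`, the degrees of the homology
of the Koszul complexes are bounded independently of `d`. -/
theorem IsMulStable.exists_koszulVanishes [CharZero k] (hI : IsMulStable 𝓑 I)
    (hx : Submodule.span k (Set.range x) = ⊤) (hgen : Algebra.adjoin k (𝓑 1 : Set B) = ⊤) (i : ℕ) :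
    ∃ C, ∀ d j, C < j →
      KoszulVanishes k (𝓑 d) (quotientDegree (symPow k (𝓑 d)) (I d)) i j := by
  obtain ⟨C, hC⟩ := (isStableFamily_cyclesFamily 𝓑 I x (i := i)).exists_bound
  -- the summand `i` ensures that `j ≥ i`, as the representation by words requires
  refine ⟨C + i, fun d j hj z hz hDz => ?_⟩
  obtain ⟨m, rfl⟩ := Nat.exists_eq_add_of_le (show i ≤ j by omega)
  obtain ⟨t, ht, rfl⟩ := exists_mem_cyclesFamily_wordMap_eq 𝓑 x hI hx hgen hz hDz
  obtain ⟨N, hN⟩ : ∃ N, i + m = N + 1 := ⟨i + m - 1, by omega⟩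
  rw [hN] at ht ⊢
  exact exists_koszulD_eq_wordMap 𝓑 I x (hC d N (by omega) ht)

end Surjectivity

lemma secantTorDegree_eq_bot {k : Type u} [Field k] [CharZero k] {B : Type v} [CommRing B]
    [Algebra k B] (𝓑 : ℕ → Submodule k B) [GradedAlgebra 𝓑] {d : ℕ} [FiniteDimensional k (𝓑 d)]
    {r i j : ℕ} (h : KoszulVanishes k (𝓑 d)
      (quotientDegree (symPow k (𝓑 d)) (secantIdeal 𝓑 d r)) i j) :
    secantTorDegree 𝓑 d r i j = ⊥ :=
  (standardResolution (symPow k (𝓑 d)) (quotientDegree (symPow k (𝓑 d)) (secantIdeal 𝓑 d r))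
    (Sec.isGradedModule 𝓑 d r)).homologyDegree_eq_bot (Sec.isGradedModule 𝓑 d r) h

theorem mainTheorem1 {k : Type u} [Field k] [CharZero k] {B : Type v} [CommRing B] [Algebra k B]
    (𝓑 : ℕ → Submodule k B) [GradedAlgebra 𝓑] [FiniteDimensional k (𝓑 1)]
    (hgen : Algebra.adjoin k (𝓑 1 : Set B) = ⊤) :
    ∃ C : ℕ → ℕ → ℕ, ∀ i r d : ℕ, 1 ≤ r →
      ∀ j : ℕ, C i r < j → secantTorDegree 𝓑 d r i j = ⊥ := by
  have hspan := (Module.finBasis k (𝓑 1)).span_eq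
  have hfin := finiteDimensional_of_adjoin_eq_top 𝓑 (Module.finBasis k (𝓑 1)) hspan hgen
  -- for `r = 0` there is no condition on the bound
  have h : ∀ i r, ∃ C, 1 ≤ r → ∀ d j : ℕ, C < j →
      KoszulVanishes k (𝓑 d) (quotientDegree (symPow k (𝓑 d)) (secantIdeal 𝓑 d r)) i j := by
    intro i r
    by_cases hr : 1 ≤ r
    · obtain ⟨C, hC⟩ := (isMulStable_secantIdeal 𝓑 hr).exists_koszulVanishes 𝓑
        (Module.finBasis k (𝓑 1)) hspan hgen i
      exact ⟨C, fun _ => hC⟩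
    · exact ⟨0, fun h => absurd h hr⟩
  choose C hC using h
  exact ⟨C, fun i r d hr j hj => secantTorDegree_eq_bot 𝓑 (hC i r hr d j hj)⟩
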